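/- Let $d\ge 2$. Let $\Phi$ and $M$ be norms on $\mathbb R^d$ that need not be even (nonnegative, zero only at $0$, subadditive, $\Phi(\lambda n)=\lambda\Phi(n)$ for $\lambda\ge 0$). Let $A(x)=Lx+b$ be an affine map of $\mathbb R^d$ with $\det L\neq 0$, and put $\Phi_A(q)=\Phi(L^Tq)$ and $M_A(q)=M(L^Tq)$. Definitions. An oriented surface $S$ is a countably $(d-1)$-rectifiable, $\mathcal H^{d-1}$-measurable subset of $\mathbb R^d$ with locally finite $\mathcal H^{d-1}$-measure, together with a measurable field $n_S$ of unit normals (orthogonal to the approximate tangent planes a.e.). Its energy is $\Phi(S)=\int_S\Phi(n_S)\,d\mathcal H^{d-1}\in[0,\infty]$. Its image under a diffeomorphism $\varphi$ is $\varphi(S)$ with the normal $n_{\varphi(S)}(\varphi(x))=(D\varphi_x^{-1})^Tn_S(x)/|(D\varphi_x^{-1})^Tn_S(x)|$. A test field is a smooth compactly supported vector field $g$. It deforms $S$ into $(\mathrm{id}+hg)(S)$; write $E_g(h)$ for the energy of the part of this surface in the support of $g$, and $\int_S g\cdot n_S\,d\mathcal H^{d-1}$ is the rate at which volume is swept out at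 $h=0$. The number $\kappa$ is the weighted mean curvature of $S$ at $x\in S$ with respect to $\Phi$ (minus the rate of change of energy with volume swept out) in either of two cases. (a) $\Phi$ is differentiable at $n_S(x)$, $S$ is in a neighbourhood $U$ of $x$ an embedded $C^2$ hypersurface oriented by $n_S$, and there is a continuous function $k$ on $S\cap U$ with $k(x)=\kappa$ and $E_g'(0)=-\int_S (g\cdot n_S)\,k\,d\mathcal H^{d-1}$ for all test fields $g$ supported in $U$. (b) $\Phi$ is not differentiable at $n=n_S(x)$, $x$ lies in a bounded, relatively open flat facet $F$ of $S$ (the connected component containing $x$ of the set of points near which $S$ is, with its orientation, the hyperplane through $x$ orthogonal to $n$), and, for every $c\in\mathbb R$, $-\kappa\,c\,\mathcal H^{d-1}(F)$ is the least limit of the right derivatives $E_{g}'(0^+)$ along uniformly bounded test fields $g$ with $g\cdot n=c$ on $F$ whose supports shrink to $\overline F$ (it is a lower bound for the lower limits and is attained). A motion on $[0,T]$ by weighted mean curvature with respect to $\Phi$ with mobility $M$ is a family $C(t)$ of oriented surfaces with sets $\Sigma(t)$ of singular points such that the following hold. For a.e. $t$, $\Sigma(t)\cap C(t)$ is $\mathcal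 H^{d-1}$-null. The family is continuous: limits of points of $C(s)$ as $s\to t$ lie in $\overline{C(t)}$; for each $t$, $\mathcal H^{d-1}$-a.e. point of $C(t)$ has each of its neighbourhoods met by $C(s)$ for all $s$ near $t$; and the normal is continuous in $(t,x)$ at nonsingular points. At every $t\in[0,T]$ and every $x\in C(t)\setminus\Sigma(t)$ the weighted mean curvature $\kappa_\Phi(C(t),x)$ exists and the normal velocity of $C(t)$ at $x$ is $M(n_{C(t)}(x))\,\kappa_\Phi(C(t),x)$; here the normal velocity is the common value of $\gamma'(t)\cdot n_{C(t)}(x)$ over all paths $\gamma$ with $\gamma(t)=x$ and $\gamma(s)\in C(s)$ for $s$ near $t$ that are differentiable at $t$, at least one of which must exist. Theorem. 1. $\Phi_A$ and $M_A$ are again norms (not necessarily even). For every oriented surface $S$, $A(S)$ is an oriented surface and $$\int_{A(S)}\Phi_A(n_{A(S)})\,d\mathcal H^{d-1}=|\det L|\int_S\Phi(n_S)\,d\mathcal H^{d-1}.$$ 2. $|A(\Omega)|=|\det L|\,|\Omega|$ for every $\Omega\subset\mathbb R^d$ ($|\cdot|$ being Lebesgue (outer) measure), and for every oriented surface $S$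 and test field $g$, with $g_A=L\circ g\circ A^{-1}$, $$\int_{A(S)}g_A\cdot n_{A(S)}\,d\mathcal H^{d-1}=|\det L|\int_S g\cdot n_S\,d\mathcal H^{d-1}.$$ 3. For every oriented surface $S$, every $x$ and every $\kappa$: $\kappa$ is the weighted mean curvature of $S$ at $x$ with respect to $\Phi$ if and only if it is the weighted mean curvature of $A(S)$ at $A(x)$ with respect to $\Phi_A$. 4. $C(t)$ with singular sets $\Sigma(t)$ is a motion for $(\Phi,M)$ if and only if $A(C(t))$ with singular sets $A(\Sigma(t))$ is a motion for $(\Phi_A,M_A)$, and every motion for $(\Phi_A,M_A)$ arises in this way. Consequently, let $C(t)$ be a motion for $(\Phi,M)$ and $C_A(t)$ a motion for $(\Phi_A,M_A)$ with $C_A(0)=A(C(0))$. If both $A(C(t))$ and $C_A(t)$, with their singular sets, belong to some class of families in which motions for $(\Phi_A,M_A)$ are determined by their initial surface, then $C_A(t)=A(C(t))$ for all $t\in[0,T]$. (Equality of oriented surfaces means equality of the sets and a.e. equality of the normals.) -/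

import Mathlib

open Set Filter Topology MeasureTheory
open scoped ContDiff RealInnerProductSpace

noncomputable section

/-- Euclidean space `ℝ^d`. -/
abbrev Eucl (d : ℕ) : Type := EuclideanSpace ℝ (Fin d)

/-- A norm on `ℝ^d` that is not necessarily even. -/
structure IsAsymNorm {d : ℕ} (Φ : Eucl d → ℝ) : Prop where
  nonneg : ∀ n, 0 ≤ Φ n
  eq_zero_iff : ∀ n, Φ n = 0 ↔ n = 0
  pos_homog : ∀ (r : ℝ) (n : Eucl d), 0 ≤ r → Φ (r • n) = r * Φ n
  subadd : ∀ n p, Φ (n + p) ≤ Φ n + Φ p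

/-- The affine map `x ↦ L x + b`. -/
def affMap {d : ℕ} (L : Eucl d →L[ℝ] Eucl d) (b : Eucl d) : Eucl d → Eucl d :=
  fun x => L x + b

/-- The transformed energy (or mobility) `Φ_A(q) = Φ(Lᵀ q)`. -/
def transf {d : ℕ} (L : Eucl d →L[ℝ] Eucl d) (Φ : Eucl d → ℝ) : Eucl d → ℝ :=
  fun q => Φ (ContinuousLinearMap.adjoint L q)

/-- A subset of `ℝ^d` together with a field of vectors on it; the values of the field off the set
are irrelevant. `IsOrientedSurface` says when this is an oriented rectifiable hypersurface. -/
structure OrientedSet (d : ℕ) where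
  carrier : Set (Eucl d)
  normal : Eucl d → Eucl d

/-- `n` is a unit vector and the hyperplane orthogonal to `n` is an approximate tangent plane
of `S` at `x`: the part of `S` near `x` outside any cone around `x + n^⊥` has
`(d-1)`-dimensional density zero at `x`. (This is used at almost every point of a rectifiable set,
where the upper density of `S` is automatically positive and the plane is unique.) -/
def IsUnitNormalAt {d : ℕ} (S : Set (Eucl d)) (x n : Eucl d) : Prop :=
  ‖n‖ = 1 ∧ ∀ ε : ℝ, 0 < ε →
    Tendsto (fun r : ℝ =>
        μHE[d - 1] (S ∩ Metric.closedBall x r ∩ {z | ε * ‖z - x‖ < |⟪z - x, n⟫|})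
          / ENNReal.ofReal (r ^ (d - 1)))
      (𝓝[>] 0) (𝓝 0)

/-- A `(d-1)`-dimensional oriented rectifiable surface in `ℝ^d`: `(d-1)`-dimensional Hausdorff
measure on it is finite on bounded parts, almost all of it is covered by countably many Lipschitz
images of `ℝ^(d-1)`, and it carries a measurable field of unit normals. -/
structure IsOrientedSurface {d : ℕ} (S : OrientedSet d) : Prop where
  nullMeasurable : NullMeasurableSet S.carrier μHE[d - 1]
  locallyFinite : ∀ K : Set (Eucl d), IsCompact K → μHE[d - 1] (S.carrier ∩ K) < ⊤
  rectifiable : ∃ f : ℕ → Eucl (d - 1) → Eucl d, (∀ i, ∃ C, LipschitzWith C (f i)) ∧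
    μHE[d - 1] (S.carrier \ ⋃ i, range (f i)) = 0
  measurable_normal : AEMeasurable S.normal (μHE[d - 1].restrict S.carrier)
  isUnitNormal : ∀ᵐ x ∂(μHE[d - 1].restrict S.carrier), IsUnitNormalAt S.carrier x (S.normal x)

/-- The two oriented sets are the same oriented surface: the sets are equal and the normals agree
almost everywhere. -/
def SameSurface {d : ℕ} (S S' : OrientedSet d) : Prop :=
  S.carrier = S'.carrier ∧ ∀ᵐ x ∂(μHE[d - 1].restrict S.carrier), S.normal x = S'.normal x

/-- The vector of the same length as `n` in the direction of `(P⁻¹)ᵀ n`; for a unit vector `n` it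
is `(P⁻¹)ᵀ n / |(P⁻¹)ᵀ n|`. -/
def conormal {d : ℕ} (P : Eucl d →L[ℝ] Eucl d) (n : Eucl d) : Eucl d :=
  (‖n‖ / ‖(ContinuousLinearMap.adjoint P).inverse n‖) •
    (ContinuousLinearMap.adjoint P).inverse n

/-- The image of an oriented surface under a diffeomorphism `φ` of `ℝ^d`. -/
def OrientedSet.map {d : ℕ} (S : OrientedSet d) (φ : Eucl d → Eucl d) : OrientedSet d where
  carrier := φ '' S.carrier
  normal := fun y =>
    conormal (fderiv ℝ φ (Function.invFun φ y)) (S.normal (Function.invFun φ y))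

/-- The part of an oriented surface in a set `K`. -/
def OrientedSet.part {d : ℕ} (S : OrientedSet d) (K : Set (Eucl d)) : OrientedSet d where
  carrier := S.carrier ∩ K
  normal := S.normal

/-- The surface energy `∫_S Φ(n_S)`, in `[0, ∞]`. -/
def energy {d : ℕ} (Φ : Eucl d → ℝ) (S : OrientedSet d) : ENNReal :=
  ∫⁻ x in S.carrier, ENNReal.ofReal (Φ (S.normal x)) ∂μHE[d - 1]

/-- Smooth vector fields with compact support in `V`. -/
def IsTestField {d : ℕ} (V : Set (Eucl d)) (g : Eucl d → Eucl d) : Prop :=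
  ContDiff ℝ ∞ g ∧ HasCompactSupport g ∧ tsupport g ⊆ V

/-- The energy of the deformed surface `(id + h g)(S)`, counted on the (compact) support of `g`,
outside of which the surface does not move. For small `|h|` the map `id + h g` is a
diffeomorphism. -/
def deformedEnergy {d : ℕ} (Φ : Eucl d → ℝ) (S : OrientedSet d) (g : Eucl d → Eucl d)
    (h : ℝ) : ℝ :=
  (energy Φ ((S.part (tsupport g)).map fun x => x + h • g x)).toReal

/-- The rate at which (signed) volume is swept out by `S` under the deformation `id + h g`. -/
def volumeRate {d : ℕ} (S : OrientedSet d) (g : Eucl d → Eucl d) : ℝ :=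
  ∫ x in S.carrier, ⟪g x, S.normal x⟫ ∂μHE[d - 1]

/-- In `U`, the set `S` is a `C²` embedded hypersurface oriented by its normal field. -/
def IsRegularIn {d : ℕ} (S : OrientedSet d) (U : Set (Eucl d)) : Prop :=
  ∃ u : Eucl d → ℝ, ContDiffOn ℝ 2 u U ∧ S.carrier ∩ U = {z ∈ U | u z = 0} ∧
    ∀ z ∈ S.carrier ∩ U, gradient u z ≠ 0 ∧ S.normal z = ‖gradient u z‖⁻¹ • gradient u z

/-- Weighted mean curvature at a regular point: near `x` the first variation of the energy is
represented by `g ↦ -∫_S (g · n_S) k` with a continuous function `k` on `S`, and `k x = κ`. -/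
def HasRegularWMC {d : ℕ} (Φ : Eucl d → ℝ) (S : OrientedSet d) (x : Eucl d) (κ : ℝ) : Prop :=
  x ∈ S.carrier ∧ DifferentiableAt ℝ Φ (S.normal x) ∧
  ∃ U : Set (Eucl d), IsOpen U ∧ x ∈ U ∧ IsRegularIn S U ∧
  ∃ k : Eucl d → ℝ, ContinuousOn k (S.carrier ∩ U) ∧ k x = κ ∧
    ∀ g, IsTestField U g →
      HasDerivAt (deformedEnergy Φ S g)
        (-∫ y in S.carrier, ⟪g y, S.normal y⟫ * k y ∂μHE[d - 1]) 0

/-- The points of `S` in the hyperplane through `x` orthogonal to `n_S(x)` near which `S`, with its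
orientation, is that hyperplane. -/
def flatPart {d : ℕ} (S : OrientedSet d) (x : Eucl d) : Set (Eucl d) :=
  {y | ⟪y - x, S.normal x⟫ = 0 ∧ ∃ r : ℝ, 0 < r ∧
    S.carrier ∩ Metric.ball y r = {z ∈ Metric.ball y r | ⟪z - x, S.normal x⟫ = 0} ∧
    ∀ z ∈ S.carrier ∩ Metric.ball y r, S.normal z = S.normal x}

/-- The (relatively open) facet of `S` that contains `x`. -/
def facet {d : ℕ} (S : OrientedSet d) (x : Eucl d) : Set (Eucl d) :=
  connectedComponentIn (flatPart S x) x

/-- Test fields supported in `V` and bounded by `B` that move the facet through `x` parallel to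
itself, with normal speed `c`. -/
def IsFacetField {d : ℕ} (S : OrientedSet d) (x : Eucl d) (c B : ℝ) (V : Set (Eucl d))
    (g : Eucl d → Eucl d) : Prop :=
  IsTestField V g ∧ (∀ y, ‖g y‖ ≤ B) ∧ ∀ y ∈ facet S x, ⟪g y, S.normal x⟫ = c

/-- Weighted mean curvature on a facet whose normal is a direction of non-differentiability of `Φ`,
by non-local deformations: `-κ` is the rate of change of energy with swept-out volume when the
facet as a whole is moved parallel to itself and the adjoining parts of `S` adapt, near the facet,
so as to have the least energy. In formulas: for each normal speed `c` of the facet, the right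
derivatives at `0` of the deformed energy, for uniformly bounded fields whose supports shrink to the
facet, have lower limit at least `-κ c |facet|`, and this value is attained in the limit. -/
def HasFacetWMC {d : ℕ} (Φ : Eucl d → ℝ) (S : OrientedSet d) (x : Eucl d) (κ : ℝ) : Prop :=
  x ∈ S.carrier ∧ ¬ DifferentiableAt ℝ Φ (S.normal x) ∧
  x ∈ flatPart S x ∧ Bornology.IsBounded (facet S x) ∧
  ∀ c : ℝ,
    (∀ B ε : ℝ, 0 < ε → ∃ V, IsOpen V ∧ closure (facet S x) ⊆ V ∧
      ∀ g e, IsFacetField S x c B V g →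
        HasDerivWithinAt (deformedEnergy Φ S g) e (Ici 0) 0 →
        -κ * (c * (μHE[d - 1] (facet S x)).toReal) - ε ≤ e) ∧
    (∃ B : ℝ, ∀ ε : ℝ, 0 < ε → ∀ V, IsOpen V → closure (facet S x) ⊆ V →
      ∃ g e, IsFacetField S x c B V g ∧
        HasDerivWithinAt (deformedEnergy Φ S g) e (Ici 0) 0 ∧
        e ≤ -κ * (c * (μHE[d - 1] (facet S x)).toReal) + ε)

/-- `κ` is the weighted mean curvature of `S` at `x` with respect to `Φ`: minus the rate of change
of surface energy with the volume swept out under deformations of `S`. -/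
def HasWMC {d : ℕ} (Φ : Eucl d → ℝ) (S : OrientedSet d) (x : Eucl d) (κ : ℝ) : Prop :=
  HasRegularWMC Φ S x κ ∨ HasFacetWMC Φ S x κ

/-- A path through `x` at time `t` that stays on the moving surface near time `t`. -/
def IsPathOn {d : ℕ} (C : ℝ → OrientedSet d) (T t : ℝ) (x : Eucl d) (γ : ℝ → Eucl d) : Prop :=
  γ t = x ∧ ∀ᶠ s in 𝓝[Icc 0 T] t, γ s ∈ (C s).carrier

/-- At time `t` the moving surface has normal velocity `v` at `x`: some path on it through `x` has
a velocity at time `t`, and all such velocities have normal component `v`. -/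
def HasNormalVelocity {d : ℕ} (C : ℝ → OrientedSet d) (T t : ℝ) (x : Eucl d) (v : ℝ) : Prop :=
  (∃ γ w, IsPathOn C T t x γ ∧ HasDerivWithinAt γ w (Icc 0 T) t) ∧
  ∀ γ w, IsPathOn C T t x γ → HasDerivWithinAt γ w (Icc 0 T) t → ⟪w, (C t).normal x⟫ = v

/-- `C t`, `t ∈ [0, T]`, is a family of oriented surfaces moving by weighted mean curvature with
respect to `Φ` with mobility `M`, where `Sing t` is the set of singular points (corners, junctions)
of `C t`, which is negligible for almost every `t`. The family varies continuously: no part of it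
jumps (`upper`), no part of positive area disappears or appears suddenly (`lower`), and the
orientation is continuous at nonsingular points. At every nonsingular point the normal velocity is
`M(n)` times the weighted mean curvature. -/
structure IsMotion {d : ℕ} (Φ M : Eucl d → ℝ) (T : ℝ) (C : ℝ → OrientedSet d)
    (Sing : ℝ → Set (Eucl d)) : Prop where
  surface : ∀ t ∈ Icc 0 T, IsOrientedSurface (C t)
  sing_null : ∀ᵐ t ∂(volume.restrict (Icc 0 T)), μHE[d - 1] ((C t).carrier ∩ Sing t) = 0
  upper : ∀ t ∈ Icc 0 T, ∀ x, x ∉ closure (C t).carrier →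
    ∀ᶠ p in 𝓝[Icc 0 T] t ×ˢ 𝓝 x, p.2 ∉ (C p.1).carrier
  lower : ∀ t ∈ Icc 0 T, ∀ᵐ x ∂(μHE[d - 1].restrict (C t).carrier), ∀ N ∈ 𝓝 x,
    ∀ᶠ s in 𝓝[Icc 0 T] t, ((C s).carrier ∩ N).Nonempty
  normal_cont : ContinuousOn (fun p : ℝ × Eucl d => (C p.1).normal p.2)
    {p | p.1 ∈ Icc 0 T ∧ p.2 ∈ (C p.1).carrier \ Sing p.1}
  velocity : ∀ t ∈ Icc 0 T, ∀ x ∈ (C t).carrier \ Sing t, ∃ κ,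
    HasWMC Φ (C t) x κ ∧ HasNormalVelocity C T t x (M ((C t).normal x) * κ)

end

/-!
Put `A(x) = L x + b`. The unit normal of `A(S)` at `A(x)` is `(L⁻¹)ᵀ n / |(L⁻¹)ᵀ n|`, so by
homogeneity `Φ_A(n_{A(S)}) = Φ(n_S) / |(L⁻¹)ᵀ n_S|` (`transf_conormal`): the adjoint in the definition
of `Φ_A` undoes the inverse adjoint. The area element of `S` is multiplied by
`|det L| |(L⁻¹)ᵀ n_S|` (`map_affMap_withDensity`). The product of the two factors is `|det L|`, which
is the scaling of the energy (`energy_map_affMap`). Fluxes `g · n` scale in the same way, since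
`⟪L g, (L⁻¹)ᵀ n⟫ = ⟪g, n⟫` (`integral_inner_map_affMap`).

The substance is the area formula for a linear isomorphism `e` on a rectifiable set whose normals are
defined by approximate tangent planes. For subsets of a hyperplane the factor comes from comparing the
volume of a cylinder with that of its image (`euclideanHausdorffMeasure_image_hyperplane`). In general,
it is enough to bound the area of images from above (`restrict_map_symm_le`), because the upper bound
for `e⁻¹` on the image surface is the lower bound for `e` (`restrict_map_symm_eq`). For the upper bound
the surface is cut, up to null sets, into countably many pieces that are almost flat. On a piece where a
Lipschitz parametrization follows an injective linear map, Lebesgue density points show that an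
approximate normal of the surface is almost orthogonal to the range of that map
(`ae_abs_inner_le_of_approximatesLinearOn`), and an almost flat piece is compared with its projection to
a hyperplane (`euclideanHausdorffMeasure_image_le_of_almost_flat`). Points where the differential of the
parametrization is not injective have a null image
(`euclideanHausdorffMeasure_image_of_not_injective_fderiv`).

Next, `A` conjugates `id + h g` to `id + h g_A` with `g_A = L ∘ g ∘ A⁻¹`. For small `h` these maps are
diffeomorphisms that preserve oriented surfaces, so energies of deformed surfaces scale by `|det L|`
(`eventually_deformedEnergy_transf`). Energy change and swept volume thus scale alike, and their ratio,
the weighted mean curvature, is invariant (`hasWMC_map_affMap_iff`); for a facet, the normal speed times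
the area scales by `|det L|`. The normal velocity at `A(x)` is the one at `x` divided by
`|(L⁻¹)ᵀ n|`, and so is `M_A(n_{A(S)})` compared with `M(n_S)`; the law of motion is preserved
(`IsMotion.map_affMap`). Converses follow by applying the same statements to `A⁻¹`, since mapping by `A`
and then by `A⁻¹` gives back the same oriented set and the same `Φ` and `M`.
-/

open scoped NNReal ENNReal

/-! ### Area of subsets of a hyperplane under a linear isomorphism -/

theorem euclideanHausdorffMeasure_image_le_of_lipschitzOnWith {X Y : Type*}
    [EMetricSpace X] [MeasurableSpace X] [BorelSpace X]
    [EMetricSpace Y] [MeasurableSpace Y] [BorelSpace Y] {f : X → Y} {s : Set X} {K : NNReal}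
    (h : LipschitzOnWith K f s) (k : ℕ) :
    (μHE[k] : Measure Y) (f '' s) ≤ (K : ENNReal) ^ k * (μHE[k] : Measure X) s := by
  simp only [Measure.euclideanHausdorffMeasure_def, Measure.smul_apply]
  have := h.hausdorffMeasure_image_le (d := k) (by positivity)
  rw [ENNReal.rpow_natCast] at this
  rw [ENNReal.smul_def, ENNReal.smul_def, smul_eq_mul, smul_eq_mul, mul_left_comm]
  gcongr

theorem euclideanHausdorffMeasure_image_add_const {d : ℕ} (k : ℕ) (s : Set (Eucl d)) (c : Eucl d) :
    (μHE[k] : Measure (Eucl d)) ((fun x => x + c) '' s) = μHE[k] s :=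
  (Isometry.of_dist_eq fun x y => dist_add_right x y c).euclideanHausdorffMeasure_image s

theorem adjoint_symm_ne_zero {d : ℕ} (e : Eucl d ≃L[ℝ] Eucl d) {n : Eucl d} (hn : n ≠ 0) :
    ContinuousLinearMap.adjoint (e.symm : Eucl d →L[ℝ] Eucl d) n ≠ 0 := by
  intro h
  apply hn
  refine ext_inner_left ℝ fun v => ?_
  have := ContinuousLinearMap.adjoint_inner_right (e.symm : Eucl d →L[ℝ] Eucl d) (e v) n
  simpa [h] using this.symm

theorem inner_map_adjoint_symm {d : ℕ} (e : Eucl d ≃L[ℝ] Eucl d) (v n : Eucl d) :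
    ⟪e v, ContinuousLinearMap.adjoint (e.symm : Eucl d →L[ℝ] Eucl d) n⟫ = ⟪v, n⟫ := by
  simp [ContinuousLinearMap.adjoint_inner_right]

/-- Volume of the image of a cylinder of height `1` over the unit disc of `n^⊥`, by slicing along
`m = (e⁻¹)ᵀ n`. The image slab has thickness `1 / |m|`, and all its slices are translates of the
image of the disc. -/
theorem volume_image_cylinder {d : ℕ} (e : Eucl d ≃L[ℝ] Eucl d) {n m : Eucl d}
    (hn : ‖n‖ = 1)
    (hm : ContinuousLinearMap.adjoint (e.symm : Eucl d →L[ℝ] Eucl d) n = m) :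
    volume (e '' {x | 0 ≤ ⟪x, n⟫ ∧ ⟪x, n⟫ ≤ 1 ∧ ‖x - ⟪x, n⟫ • n‖ ≤ 1}) =
      ENNReal.ofReal (1 / ‖m‖) * μHE[d - 1] (e '' {x | ⟪x, n⟫ = 0 ∧ ‖x‖ ≤ 1}) := by
  have hn0 : n ≠ 0 := by rintro rfl; simp at hn
  have hm0 : m ≠ 0 := hm ▸ adjoint_symm_ne_zero e hn0
  have hmp : 0 < ‖m‖ := norm_pos_iff.2 hm0
  have hin : ∀ v, ⟪e v, m⟫ = ⟪v, n⟫ := fun v => hm ▸ inner_map_adjoint_symm e v n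
  have hnn : ⟪n, n⟫ = 1 := by rw [real_inner_self_eq_norm_sq, hn]; norm_num
  set K : Set (Eucl d) := {x | 0 ≤ ⟪x, n⟫ ∧ ⟪x, n⟫ ≤ 1 ∧ ‖x - ⟪x, n⟫ • n‖ ≤ 1} with hK
  set D : Set (Eucl d) := {x | ⟪x, n⟫ = 0 ∧ ‖x‖ ≤ 1} with hD
  have hKc : IsClosed K := by
    have h1 : IsClosed {x : Eucl d | 0 ≤ ⟪x, n⟫} := isClosed_le (by fun_prop) (by fun_prop)
    have h2 : IsClosed {x : Eucl d | ⟪x, n⟫ ≤ 1} := isClosed_le (by fun_prop) (by fun_prop)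
    have h3 : IsClosed {x : Eucl d | ‖x - ⟪x, n⟫ • n‖ ≤ 1} :=
      isClosed_le (by fun_prop) (by fun_prop)
    exact h1.inter (h2.inter h3)
  have hKm : MeasurableSet (e '' K) := (e.toHomeomorph.isClosedMap K hKc).measurableSet
  -- Fubini for the hyperplanes orthogonal to `m`, with `y ∈ K` in the slice `⟪y, n⟫ = x * ‖m‖ ^ 2`
  have key := EuclideanGeometry.euclideanHausdorffMeasure_eq_lintegral (0 : Eucl d) hm0 hKm
  rw [InnerProductSpace.euclideanHausdorffMeasure_eq_volume] at key
  rw [key, finrank_euclideanSpace_fin]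
  have hslice : ∀ x : ℝ, μHE[d - 1] (e '' K ∩ AffineSubspace.mk' (x • m +ᵥ (0 : Eucl d)) (ℝ ∙ m)ᗮ)
      = (Icc 0 (1 / ‖m‖ ^ 2)).indicator (fun _ => μHE[d - 1] (e '' D)) x := by
    intro x
    have hset : e '' K ∩ (AffineSubspace.mk' (x • m +ᵥ (0 : Eucl d)) (ℝ ∙ m)ᗮ : Set (Eucl d)) =
        e '' (K ∩ {y | ⟪y, n⟫ = x * ‖m‖ ^ 2}) := by
      ext z
      constructor
      · rintro ⟨⟨y, hy, rfl⟩, hz⟩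
        refine ⟨y, ⟨hy, ?_⟩, rfl⟩
        have : ⟪m, e y - x • m⟫ = 0 := by
          simpa [Submodule.mem_orthogonal_singleton_iff_inner_right, AffineSubspace.mem_mk'] using hz
        rw [inner_sub_right, inner_smul_right, real_inner_self_eq_norm_sq, real_inner_comm,
          hin] at this
        simp only [mem_ofPred_eq]; linarith
      · rintro ⟨y, ⟨hy, hyx⟩, rfl⟩
        refine ⟨⟨y, hy, rfl⟩, ?_⟩
        have : ⟪m, e y - x • m⟫ = 0 := by
          rw [inner_sub_right, inner_smul_right, real_inner_self_eq_norm_sq, real_inner_comm,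
            hin]
          simp only [mem_ofPred_eq] at hyx; linarith
        simpa [Submodule.mem_orthogonal_singleton_iff_inner_right, AffineSubspace.mem_mk'] using this
    rw [hset]
    by_cases hx : x ∈ Icc 0 (1 / ‖m‖ ^ 2)
    · rw [indicator_of_mem hx]
      have hx1 : x * ‖m‖ ^ 2 ≤ 1 := by
        have := hx.2; rwa [le_div_iff₀ (by positivity)] at this
      have hx0 : 0 ≤ x * ‖m‖ ^ 2 := mul_nonneg hx.1 (by positivity)
      have : e '' (K ∩ {y | ⟪y, n⟫ = x * ‖m‖ ^ 2}) =
          (fun z => z + e ((x * ‖m‖ ^ 2) • n)) '' (e '' D) := by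
        ext z
        constructor
        · rintro ⟨y, ⟨hy, hyx⟩, rfl⟩
          simp only [mem_ofPred_eq] at hyx
          refine ⟨_, ⟨y - (x * ‖m‖ ^ 2) • n, ⟨?_, ?_⟩, rfl⟩, ?_⟩
          · rw [inner_sub_left, inner_smul_left, hnn, hyx]; simp
          · have := hy.2.2; rwa [hyx] at this
          · simp
        · rintro ⟨_, ⟨y, ⟨hy, hy1⟩, rfl⟩, rfl⟩
          have hyn : ⟪y + (x * ‖m‖ ^ 2) • n, n⟫ = x * ‖m‖ ^ 2 := by
            rw [inner_add_left, inner_smul_left, hnn, hy]; simp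
          refine ⟨y + (x * ‖m‖ ^ 2) • n, ⟨⟨?_, ?_, ?_⟩, hyn⟩, ?_⟩
          · rw [hyn]; exact hx0
          · rw [hyn]; exact hx1
          · rw [hyn]; simpa using hy1
          · simp
      rw [this, euclideanHausdorffMeasure_image_add_const]
    · rw [indicator_of_notMem hx]
      have : K ∩ {y | ⟪y, n⟫ = x * ‖m‖ ^ 2} = ∅ := by
        rw [eq_empty_iff_forall_notMem]
        rintro y ⟨⟨h0, h1, -⟩, hy⟩
        simp only [mem_ofPred_eq] at hy
        rw [hy] at h0 h1
        exact hx ⟨nonneg_of_mul_nonneg_left h0 (by positivity),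
          by rwa [le_div_iff₀ (by positivity)]⟩
      rw [this]; simp
  simp_rw [hslice]
  rw [lintegral_indicator measurableSet_Icc, setLIntegral_const, Real.volume_Icc, mul_left_comm,
    mul_comm (ENNReal.ofReal (1 / ‖m‖))]
  congr 1
  rw [← ofReal_norm, ← ENNReal.ofReal_mul (by positivity)]
  congr 1
  field_simp
  ring

/-- The case of a unit normal and of a hyperplane through the origin. The area factor of `e` on the
hyperplane is some constant `f.normDet`; its value is read off from the cylinders over the unit disc
and over its image, whose volumes are in the ratio `|det e|`. -/
theorem euclideanHausdorffMeasure_image_hyperplane_aux {d : ℕ} (e : Eucl d ≃L[ℝ] Eucl d)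
    {n : Eucl d} (hn : ‖n‖ = 1) {F : Set (Eucl d)}
    (hF : F ⊆ {y | ⟪y, n⟫ = 0}) :
    (μHE[d - 1] : Measure (Eucl d)) (e '' F) =
      ENNReal.ofReal (|(e : Eucl d →L[ℝ] Eucl d).det| *
        ‖ContinuousLinearMap.adjoint (e.symm : Eucl d →L[ℝ] Eucl d) n‖) * μHE[d - 1] F := by
  have hn0 : n ≠ 0 := by rintro rfl; simp at hn
  set m := ContinuousLinearMap.adjoint (e.symm : Eucl d →L[ℝ] Eucl d) n with hm
  have hmp : 0 < ‖m‖ := norm_pos_iff.2 (adjoint_symm_ne_zero e hn0)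
  let U := (ℝ ∙ n)ᗮ
  have hU : Module.finrank ℝ U = d - 1 := by
    have := (ℝ ∙ n).finrank_add_finrank_orthogonal
    rw [finrank_span_singleton hn0, finrank_euclideanSpace_fin] at this
    show Module.finrank ℝ (ℝ ∙ n)ᗮ = d - 1
    omega
  have hmemU : ∀ y : Eucl d, y ∈ U ↔ ⟪y, n⟫ = 0 := fun y => by
    simp only [U]
    rw [Submodule.mem_orthogonal_singleton_iff_inner_left]
  have hiso : Isometry (Subtype.val : U → Eucl d) := isometry_subtype_coe
  let f : U →ₗ[ℝ] Eucl d := e.toLinearMap ∘ₗ U.subtype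
  have himg : ∀ G : Set U, μHE[d - 1] (e '' (Subtype.val '' G)) =
      ENNReal.ofReal f.normDet * μHE[d - 1] (Subtype.val '' G : Set (Eucl d)) := by
    intro G
    rw [hiso.euclideanHausdorffMeasure_image G, ← hU,
      ← f.euclideanHausdorffMeasure_image, image_image]
    rfl
  set D : Set (Eucl d) := {x | ⟪x, n⟫ = 0 ∧ ‖x‖ ≤ 1} with hD
  have hDU : D = Subtype.val '' (Metric.closedBall (0 : U) 1) := by
    ext x
    constructor
    · rintro ⟨h0, h1⟩
      exact ⟨⟨x, (hmemU x).2 h0⟩, by simpa using h1, rfl⟩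
    · rintro ⟨y, hy, rfl⟩
      exact ⟨(hmemU _).1 y.2, by simpa using hy⟩
  have hDm : μHE[d - 1] D = (volume : Measure U) (Metric.closedBall 0 1) := by
    rw [hDU, hiso.euclideanHausdorffMeasure_image, ← hU,
      InnerProductSpace.euclideanHausdorffMeasure_eq_volume]
  have hD0 : μHE[d - 1] D ≠ 0 := by
    rw [hDm]; exact (Metric.measure_closedBall_pos _ _ one_pos).ne'
  have hDt : μHE[d - 1] D ≠ ⊤ := by
    rw [hDm]; exact measure_closedBall_lt_top.ne
  have h1 := volume_image_cylinder e hn hm.symm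
  have h2 := volume_image_cylinder (ContinuousLinearEquiv.refl ℝ (Eucl d)) hn (m := n) (by
    ext1; simp [ContinuousLinearMap.adjoint_id])
  rw [ContinuousLinearEquiv.coe_refl'] at h2
  simp only [image_id, hn, div_one, ENNReal.ofReal_one, one_mul] at h2
  rw [show (e : Eucl d → Eucl d) = (e : Eucl d →L[ℝ] Eucl d) from rfl,
    Measure.addHaar_image_continuousLinearMap, h2] at h1
  have h3 := himg (Metric.closedBall (0 : U) 1)
  rw [← hDU] at h3
  rw [show (e : Eucl d → Eucl d) = (e : Eucl d →L[ℝ] Eucl d) from rfl] at h3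
  rw [← hD, h3, ← mul_assoc] at h1
  have h4 := (ENNReal.mul_left_inj hD0 hDt).1 h1
  rw [← ENNReal.ofReal_mul (by positivity),
    ENNReal.ofReal_eq_ofReal_iff (by positivity)
      (mul_nonneg (by positivity) f.normDet_nonneg)] at h4
  have h5 : f.normDet = |(e : Eucl d →L[ℝ] Eucl d).det| * ‖m‖ := by
    rw [h4]; field_simp
  have hFU : F = Subtype.val '' (Subtype.val ⁻¹' F : Set U) := by
    ext y
    exact ⟨fun hy => ⟨⟨y, (hmemU y).2 (hF hy)⟩, hy, rfl⟩, by rintro ⟨z, hz, rfl⟩; exact hz⟩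
  rw [← h5, hFU, himg]

/-- A linear isomorphism `e` multiplies the area of a subset of a hyperplane with normal `n` by
`|det e| |(e⁻¹)ᵀ n| / |n|`. -/
theorem euclideanHausdorffMeasure_image_hyperplane {d : ℕ} (e : Eucl d ≃L[ℝ] Eucl d) {n : Eucl d}
    (hn : n ≠ 0) (x : Eucl d) {F : Set (Eucl d)}
    (hF : F ⊆ {y | ⟪y - x, n⟫ = 0}) :
    (μHE[d - 1] : Measure (Eucl d)) (e '' F) =
      ENNReal.ofReal (|(e : Eucl d →L[ℝ] Eucl d).det| *
        (‖ContinuousLinearMap.adjoint (e.symm : Eucl d →L[ℝ] Eucl d) n‖ / ‖n‖)) *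
          μHE[d - 1] F := by
  have hnp : 0 < ‖n‖ := norm_pos_iff.2 hn
  have hu : ‖‖n‖⁻¹ • n‖ = 1 := by rw [norm_smul, norm_inv, norm_norm, inv_mul_cancel₀ hnp.ne']
  have h := euclideanHausdorffMeasure_image_hyperplane_aux e hu
    (F := (fun y => y + -x) '' F) (by
      rintro _ ⟨y, hy, rfl⟩
      have : ⟪y - x, n⟫ = 0 := hF hy
      simp only [mem_ofPred_eq, ← sub_eq_add_neg, inner_smul_right, this, mul_zero])
  rw [euclideanHausdorffMeasure_image_add_const] at h
  have h2 : e '' ((fun y => y + -x) '' F) = (fun z => z + -e x) '' (e '' F) := by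
    simp only [image_image, map_add, map_neg]
  rw [h2, euclideanHausdorffMeasure_image_add_const] at h
  rw [h, map_smul, norm_smul, norm_inv, norm_norm]
  congr 3
  field_simp

/-! ### Null images and density points -/

/-- A rank-deficient linear map on `ℝ^k` is dominated by invertible maps of small determinant. -/
theorem exists_dominating_equiv_of_not_injective {k : ℕ} {F : Type*} [NormedAddCommGroup F]
    [NormedSpace ℝ F] (A : Eucl k →L[ℝ] F) (hA : ¬ Function.Injective A) {δ : ℝ} (hδ : 0 < δ) :
    ∃ (B : Eucl k ≃L[ℝ] Eucl k) (ε : ℝ≥0), ε ≠ 0 ∧ |(B : Eucl k →L[ℝ] Eucl k).det| ≤ δ ∧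
      ∀ w, ‖A w‖ + ε * ‖w‖ ≤ 5 * ‖B w‖ := by
  obtain ⟨v, hAv, hv⟩ : ∃ v, A v = 0 ∧ ‖v‖ = 1 := by
    have : ∃ v, A v = 0 ∧ v ≠ 0 := by
      by_contra! h
      exact hA ((injective_iff_map_eq_zero A).2 h)
    obtain ⟨v, h0, hv⟩ := this
    exact ⟨‖v‖⁻¹ • v, by simp [h0], by
      rw [norm_smul, norm_inv, norm_norm, inv_mul_cancel₀ (norm_ne_zero_iff.2 hv)]⟩
  have hvv : ⟪v, v⟫ = 1 := by rw [real_inner_self_eq_norm_sq, hv]; norm_num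
  -- `B ε` is a large multiple of the identity on `v^⊥` and `ε` on the kernel direction `v`
  let Q : Eucl k →L[ℝ] Eucl k := (innerSL ℝ v).smulRight v
  let P : Eucl k →L[ℝ] Eucl k := ContinuousLinearMap.id ℝ _ - Q
  let B : ℝ → Eucl k →L[ℝ] Eucl k := fun ε => (‖A‖ + 1) • P + ε • Q
  have hQ : ∀ w, Q w = ⟪v, w⟫ • v := fun w => by simp [Q]
  have hP : ∀ w, P w = w - ⟪v, w⟫ • v := fun w => by simp [P, hQ]
  have hB : ∀ ε w, B ε w = (‖A‖ + 1) • P w + ε • Q w := fun ε w => by simp [B]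
  have hB0 : (B 0).det = 0 := by
    by_contra h
    have h1 : B 0 v = 0 := by rw [hB, hP, hvv]; simp
    rw [← ContinuousLinearMap.toContinuousLinearEquivOfDetNeZero_apply _ h] at h1
    have : v = 0 := (map_eq_zero_iff _ (ContinuousLinearEquiv.injective _)).1 h1
    rw [this] at hv; simp at hv
  have hcont : Continuous fun ε : ℝ => |(B ε).det| :=
    (ContinuousLinearMap.continuous_det.comp (by fun_prop)).abs
  have hev : ∀ᶠ ε in 𝓝[>] (0 : ℝ), |(B ε).det| ≤ δ := by
    have : Tendsto (fun ε : ℝ => |(B ε).det|) (𝓝[>] 0) (𝓝 0) := by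
      have := (hcont.tendsto 0).mono_left (nhdsWithin_le_nhds (s := Ioi 0))
      simpa only [hB0, abs_zero] using this
    exact (this.eventually (ge_mem_nhds hδ))
  obtain ⟨ε, hdet, hε0, hε1⟩ := (hev.and (Ioc_mem_nhdsGT (zero_lt_one' ℝ))).exists
  have hin : ∀ w, ε * |⟪v, w⟫| ≤ ‖B ε w‖ := by
    intro w
    have h1 : ⟪v, B ε w⟫ = ε * ⟪v, w⟫ := by
      rw [hB, hP, hQ, inner_add_right, inner_smul_right, inner_smul_right, inner_sub_right,
        inner_smul_right, hvv]; ring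
    have h2 := abs_real_inner_le_norm v (B ε w)
    rwa [h1, hv, one_mul, abs_mul, abs_of_pos hε0] at h2
  have hPn : ∀ w, (‖A‖ + 1) * ‖P w‖ ≤ 2 * ‖B ε w‖ := by
    intro w
    have h1 : (‖A‖ + 1) • P w = B ε w - ε • Q w := by rw [hB]; abel
    have h2 := norm_sub_le (B ε w) (ε • Q w)
    rw [← h1, norm_smul, norm_smul, hQ, norm_smul, hv, mul_one, Real.norm_eq_abs,
      Real.norm_eq_abs, Real.norm_eq_abs, abs_of_pos hε0, abs_of_nonneg (by positivity)] at h2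
    linarith [hin w]
  have hbound : ∀ w, ‖A w‖ + ε * ‖w‖ ≤ 5 * ‖B ε w‖ := by
    intro w
    have h1 : ‖A w‖ ≤ ‖A‖ * ‖P w‖ := by
      have : A w = A (P w) := by rw [hP]; simp [hAv]
      rw [this]; exact A.le_opNorm _
    have h2 : ‖w‖ ≤ ‖P w‖ + |⟪v, w⟫| := by
      have : w = P w + ⟪v, w⟫ • v := by rw [hP]; abel
      calc ‖w‖ = ‖P w + ⟪v, w⟫ • v‖ := by rw [← this]
        _ ≤ _ := (norm_add_le _ _).trans (by rw [norm_smul, hv, mul_one, Real.norm_eq_abs])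
    have h3 : ε * ‖w‖ ≤ ‖P w‖ + ε * |⟪v, w⟫| := by
      calc ε * ‖w‖ ≤ ε * (‖P w‖ + |⟪v, w⟫|) := by gcongr
        _ ≤ 1 * ‖P w‖ + ε * |⟪v, w⟫| := by rw [mul_add]; gcongr
        _ = _ := by ring
    linarith [hin w, hPn w, norm_nonneg (B ε w)]
  have hdet0 : (B ε).det ≠ 0 := by
    intro h
    obtain ⟨w, hw, hw0⟩ : ∃ w, w ≠ 0 ∧ B ε w = 0 := by
      have := LinearMap.bot_lt_ker_of_det_eq_zero h
      obtain ⟨w, hw, hw0⟩ := (Submodule.ne_bot_iff _).1 this.ne'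
      exact ⟨w, hw0, hw⟩
    have := hbound w
    rw [hw0, norm_zero, mul_zero] at this
    have h4 : 0 < ‖w‖ := norm_pos_iff.2 hw
    nlinarith [norm_nonneg (A w), mul_pos hε0 h4]
  refine ⟨(B ε).toContinuousLinearEquivOfDetNeZero hdet0, ⟨ε, hε0.le⟩, ?_, ?_, ?_⟩
  · intro h; exact hε0.ne' (congrArg NNReal.toReal h)
  · simpa using hdet
  · intro w; exact hbound w

/-- Sard-type lemma: points where the differential is not injective have an image of zero
`k`-dimensional measure. -/
theorem euclideanHausdorffMeasure_image_of_not_injective_fderiv {k : ℕ} {F : Type*}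
    [NormedAddCommGroup F] [NormedSpace ℝ F] [SecondCountableTopology F] [MeasurableSpace F]
    [BorelSpace F] (f : Eucl k → F) :
    (μHE[k] : Measure F)
      (f '' {p | DifferentiableAt ℝ f p ∧ ¬ Function.Injective (fderiv ℝ f p)}) = 0 := by
  set Z := {p | DifferentiableAt ℝ f p ∧ ¬ Function.Injective (fderiv ℝ f p)} with hZ
  have hZU : Z = ⋃ N : ℕ, Z ∩ Metric.ball 0 N := by
    rw [← inter_iUnion, Metric.iUnion_ball_nat, inter_univ]
  rw [hZU, image_iUnion]
  refine measure_iUnion_null fun N => ?_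
  set s := Z ∩ Metric.ball 0 (N : ℝ) with hs
  have hfin : volume s ≠ ⊤ :=
    ((measure_mono inter_subset_right).trans_lt measure_ball_lt_top).ne
  -- on each piece of the partition `f` factors through a map of small determinant
  have key : ∀ δ : ℝ≥0, 0 < δ → (μHE[k] : Measure F) (f '' s) ≤ δ * (5 ^ k * volume s) := by
    intro δ hδ
    have hr : ∀ A : Eucl k →L[ℝ] F, ∃ r : ℝ≥0, r ≠ 0 ∧ (¬ Function.Injective A →
        ∃ B : Eucl k ≃L[ℝ] Eucl k, |(B : Eucl k →L[ℝ] Eucl k).det| ≤ δ ∧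
          ∀ w, ‖A w‖ + r * ‖w‖ ≤ 5 * ‖B w‖) := by
      intro A
      by_cases hA : Function.Injective A
      · exact ⟨1, one_ne_zero, fun h => (h hA).elim⟩
      · obtain ⟨B, ε, h0, h1, h2⟩ := exists_dominating_equiv_of_not_injective A hA
          (NNReal.coe_pos.2 hδ)
        exact ⟨ε, h0, fun _ => ⟨B, h1, h2⟩⟩
    choose r hr0 hr using hr
    obtain ⟨t, A, hdisj, htm, hcov, happ, hA⟩ :=
      exists_partition_approximatesLinearOn_of_hasFDerivWithinAt f s (fderiv ℝ f)
        (fun x hx => hx.1.1.hasFDerivAt.hasFDerivWithinAt) r hr0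
    have hpiece : ∀ n, (μHE[k] : Measure F) (f '' (s ∩ t n)) ≤ δ * (5 ^ k * volume (t n ∩ s)) := by
      intro n
      rcases s.eq_empty_or_nonempty with hse | hsne
      · simp [hse]
      obtain ⟨y, hy, hAy⟩ := hA hsne n
      obtain ⟨B, hdet, hB⟩ := hr (A n) (by rw [hAy]; exact hy.1.2)
      have hlip : LipschitzOnWith 5 (f ∘ B.symm) (B '' (s ∩ t n)) := by
        refine LipschitzOnWith.of_dist_le_mul ?_
        rintro _ ⟨x, hx, rfl⟩ _ ⟨z, hz, rfl⟩
        have h1 := happ n x hx z hz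
        have h2 := hB (x - z)
        simp only [Function.comp, ContinuousLinearEquiv.symm_apply_apply, dist_eq_norm,
          ← map_sub]
        have h3 : ‖f x - f z‖ ≤ ‖f x - f z - A n (x - z)‖ + ‖A n (x - z)‖ := by
          simpa using norm_add_le (f x - f z - A n (x - z)) (A n (x - z))
        have : ((5 : ℝ≥0) : ℝ) = 5 := rfl
        rw [this]; linarith
      have h1 := euclideanHausdorffMeasure_image_le_of_lipschitzOnWith hlip k
      have h2 : (f ∘ B.symm) '' (B '' (s ∩ t n)) = f '' (s ∩ t n) := by
        simp [image_image]
      rw [h2, EuclideanSpace.euclideanHausdorffMeasure_eq_volume,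
        show (B : Eucl k → Eucl k) = (B : Eucl k →L[ℝ] Eucl k) from rfl,
        Measure.addHaar_image_continuousLinearMap] at h1
      calc _ ≤ _ := h1
        _ ≤ (5 : ℝ≥0∞) ^ k * (δ * volume (s ∩ t n)) := by
          gcongr
          · exact le_of_eq rfl
          · rw [← ENNReal.ofReal_coe_nnreal]; exact ENNReal.ofReal_le_ofReal hdet
        _ = _ := by rw [inter_comm]; ring
    calc (μHE[k] : Measure F) (f '' s) ≤ (μHE[k] : Measure F) (⋃ n, f '' (s ∩ t n)) := by
          rw [← image_iUnion, ← inter_iUnion, inter_eq_left.2 hcov]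
      _ ≤ ∑' n, (μHE[k] : Measure F) (f '' (s ∩ t n)) := measure_iUnion_le _
      _ ≤ ∑' n, δ * (5 ^ k * volume.restrict s (t n)) :=
          ENNReal.tsum_le_tsum fun n => by rw [Measure.restrict_apply (htm n)]; exact hpiece n
      _ = δ * (5 ^ k * volume.restrict s (⋃ n, t n)) := by
          rw [ENNReal.tsum_mul_left, ENNReal.tsum_mul_left, measure_iUnion hdisj htm]
      _ ≤ δ * (5 ^ k * volume s) := by
          rw [← Measure.restrict_apply_univ s]
          gcongr
          exact subset_univ _
  by_contra hne
  have hC : (5 : ℝ≥0∞) ^ k * volume s ≠ ⊤ := ENNReal.mul_ne_top (by finiteness) hfin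
  obtain ⟨δ, hδ0, hδ⟩ := ENNReal.exists_nnreal_pos_mul_lt hC hne
  exact (key δ hδ0).not_gt hδ

/-- At almost every parameter, an (approximate) unit normal of `S ⊇ f(T)` is almost orthogonal to
the linear map that `f` follows on `T`: around a density point, `f(T)` fills a positive fraction of
the cone in any tangential direction. -/
theorem ae_abs_inner_le_of_approximatesLinearOn {d : ℕ} {f : Eucl (d - 1) → Eucl d}
    {T : Set (Eucl (d - 1))} {A : Eucl (d - 1) →L[ℝ] Eucl d} {r c : ℝ≥0}
    (hT : MeasurableSet T) (hf : ApproximatesLinearOn f A T r)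
    (hc : ∀ x ∈ T, ∀ y ∈ T, ‖x - y‖ ≤ c * ‖f x - f y‖) {S : Set (Eucl d)}
    (hS : f '' T ⊆ S) :
    ∀ᵐ p ∂(volume.restrict T), ∀ n, IsUnitNormalAt S (f p) n → ∀ v, |⟪A v, n⟫| ≤ r * ‖v‖ := by
  -- Lebesgue density for balls that are not centred at `p`, only at distance comparable to their
  -- radius
  have hdens : ∀ᵐ p ∂(volume.restrict T), ∀ (K : ℕ) (w : ℝ → Eucl (d - 1)) (δ : ℝ → ℝ),
      Tendsto δ (𝓝[>] 0) (𝓝[>] 0) →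
      (∀ᶠ s in 𝓝[>] (0 : ℝ), p ∈ Metric.closedBall (w s) (K * δ s)) →
      Tendsto (fun s => volume (T ∩ Metric.closedBall (w s) (δ s)) /
        volume (Metric.closedBall (w s) (δ s))) (𝓝[>] 0) (𝓝 1) :=
    ae_all_iff.2 fun K => by
      filter_upwards [IsUnifLocDoublingMeasure.ae_tendsto_measure_inter_div.{_, 0} volume T K]
        with p hp w δ h1 h2
      exact hp w δ h1 h2
  filter_upwards [hdens, ae_restrict_mem hT] with p hp hpT n hn v
  -- Otherwise the points `f q`, for `q ∈ T` in the ball about `p + s • v` of radius `η * s`, all lie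
  -- outside a fixed cone around the approximate tangent plane. They have positive density at `f p`,
  -- since `f` expands distances on `T` by at least `1 / c`.
  by_contra! hlt
  set a := |⟪A v, n⟫| - r * ‖v‖ with ha
  have ha0 : 0 < a := by linarith
  have hr0 : (0 : ℝ) ≤ r := r.2
  set η := a / (2 * (‖A‖ + r + 1)) with hη
  have hη0 : 0 < η := by positivity
  have hηa : (‖A‖ + r) * η ≤ a / 2 := by
    rw [hη]
    calc (‖A‖ + r) * (a / (2 * (‖A‖ + r + 1))) ≤ (‖A‖ + r + 1) * (a / (2 * (‖A‖ + r + 1))) := by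
          exact mul_le_mul_of_nonneg_right (by linarith) (by positivity)
      _ = a / 2 := by field_simp
  set R := (‖A‖ + r + 1) * (‖v‖ + η + 1) with hR
  have hR0 : 0 < R := by positivity
  have hmaps : ∀ s : ℝ, 0 < s → f '' (T ∩ Metric.closedBall (p + s • v) (η * s)) ⊆
      S ∩ Metric.closedBall (f p) (R * s) ∩ {z | a / (4 * R) * ‖z - f p‖ < |⟪z - f p, n⟫|} := by
    rintro s hs _ ⟨q, ⟨hqT, hq⟩, rfl⟩
    set w := q - p - s • v with hw
    have hwn : ‖w‖ ≤ η * s := by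
      rw [Metric.mem_closedBall, dist_eq_norm] at hq
      rwa [hw, sub_sub]
    have hqp : q - p = s • v + w := by rw [hw]; abel
    have hqpn : ‖q - p‖ ≤ s * ‖v‖ + η * s := by
      rw [hqp]
      refine (norm_add_le _ _).trans (add_le_add ?_ hwn)
      rw [norm_smul, Real.norm_eq_abs, abs_of_pos hs]
    have happ := hf q hqT p hpT
    set z := f q - f p with hz
    have hAn : ‖A (q - p)‖ ≤ ‖A‖ * ‖q - p‖ := A.le_opNorm _
    have hz1 : ‖z‖ ≤ (‖A‖ + r) * ‖q - p‖ := by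
      have : z = (z - A (q - p)) + A (q - p) := by abel
      calc ‖z‖ = ‖(z - A (q - p)) + A (q - p)‖ := by rw [← this]
        _ ≤ _ := (norm_add_le _ _).trans (by linarith)
    have hz2 : ‖z‖ ≤ R * s := by
      refine hz1.trans ?_
      calc (‖A‖ + r) * ‖q - p‖ ≤ (‖A‖ + r + 1) * (s * ‖v‖ + η * s) := by
            exact mul_le_mul (by linarith) hqpn (norm_nonneg _) (by positivity)
        _ ≤ (‖A‖ + r + 1) * ((‖v‖ + η + 1) * s) := by gcongr; nlinarith
        _ = R * s := by rw [hR]; ring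
    have hz3 : s * (a / 2) ≤ |⟪z, n⟫| := by
      have h1 : ⟪z, n⟫ = s * ⟪A v, n⟫ + (⟪A w, n⟫ + ⟪z - A (q - p), n⟫) := by
        have : A (q - p) = s • A v + A w := by rw [hqp, map_add, map_smul]
        rw [inner_sub_left z, this, inner_add_left, inner_smul_left]
        simp only [conj_trivial]
        ring
      have h2 : |⟪A w, n⟫| ≤ ‖A‖ * (η * s) := by
        refine (abs_real_inner_le_norm _ _).trans ?_
        rw [hn.1, mul_one]
        exact (A.le_opNorm _).trans (by gcongr)
      have h3 : |⟪z - A (q - p), n⟫| ≤ r * (s * ‖v‖ + η * s) := by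
        refine (abs_real_inner_le_norm _ _).trans ?_
        rw [hn.1, mul_one]
        exact happ.trans (by gcongr)
      have h4 : |s * ⟪A v, n⟫| = s * |⟪A v, n⟫| := by rw [abs_mul, abs_of_pos hs]
      have h5 : |s * ⟪A v, n⟫| ≤ |⟪z, n⟫| + (|⟪A w, n⟫| + |⟪z - A (q - p), n⟫|) := by
        have : s * ⟪A v, n⟫ = ⟪z, n⟫ - (⟪A w, n⟫ + ⟪z - A (q - p), n⟫) := by rw [h1]; ring
        rw [this]
        exact (abs_sub _ _).trans (by gcongr; exact abs_add_le _ _)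
      have h6 : s * |⟪A v, n⟫| = s * a + s * (r * ‖v‖) := by rw [ha]; ring
      have h7 : s * ((‖A‖ + r) * η) ≤ s * (a / 2) := by gcongr
      nlinarith
    refine ⟨⟨hS (mem_image_of_mem f hqT), ?_⟩, ?_⟩
    · rw [Metric.mem_closedBall, dist_eq_norm]; exact hz2
    · show a / (4 * R) * ‖z‖ < |⟪z, n⟫|
      calc a / (4 * R) * ‖z‖ ≤ a / (4 * R) * (R * s) := by gcongr
        _ = s * a / 4 := by field_simp
        _ < s * (a / 2) := by nlinarith
        _ ≤ _ := hz3
  -- comparison of the two densities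
  set G : ℝ → Set (Eucl d) := fun ρ =>
    S ∩ Metric.closedBall (f p) ρ ∩ {z | a / (4 * R) * ‖z - f p‖ < |⟪z - f p, n⟫|} with hG
  have hG0 : Tendsto (fun s : ℝ => μHE[d - 1] (G (R * s)) / ENNReal.ofReal ((R * s) ^ (d - 1)))
      (𝓝[>] 0) (𝓝 0) := by
    refine (hn.2 (a / (4 * R)) (by positivity)).comp (g := fun ρ : ℝ => μHE[d - 1] (G ρ) / _)
      (f := fun s => R * s) ?_
    refine tendsto_nhdsWithin_iff.2 ⟨?_, ?_⟩
    · have : Tendsto (fun s : ℝ => R * s) (𝓝 0) (𝓝 (R * 0)) := tendsto_id.const_mul R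
      rw [mul_zero] at this
      exact this.mono_left nhdsWithin_le_nhds
    · filter_upwards [self_mem_nhdsWithin] with s hs
      exact mul_pos hR0 hs
  obtain ⟨K, hK⟩ := exists_nat_ge (‖v‖ / η)
  have hT1 := hp K (fun s => p + s • v) (fun s => η * s) (by
    refine tendsto_nhdsWithin_iff.2 ⟨?_, ?_⟩
    · have : Tendsto (fun s : ℝ => η * s) (𝓝 0) (𝓝 (η * 0)) := tendsto_id.const_mul η
      rw [mul_zero] at this
      exact this.mono_left nhdsWithin_le_nhds
    · filter_upwards [self_mem_nhdsWithin] with s hs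
      exact mul_pos hη0 hs) (by
    filter_upwards [self_mem_nhdsWithin] with s hs
    have hs : 0 < s := hs
    rw [div_le_iff₀ hη0] at hK
    rw [Metric.mem_closedBall, dist_eq_norm, sub_add_cancel_left, norm_neg, norm_smul,
      Real.norm_eq_abs, abs_of_pos hs]
    nlinarith)
  set β := volume (Metric.ball (0 : Eucl (d - 1)) 1) with hβ
  have hβ0 : β ≠ 0 := (Metric.measure_ball_pos _ _ one_pos).ne'
  have hβt : β ≠ ⊤ := measure_ball_lt_top.ne
  set κ : ℝ≥0∞ := (c : ℝ≥0∞) ^ (d - 1) * (ENNReal.ofReal ((R / η) ^ (d - 1)) / β) with hκ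
  have hκt : κ ≠ ⊤ := by
    refine ENNReal.mul_ne_top (by finiteness) (ENNReal.div_ne_top (by finiteness) hβ0)
  -- `f` is inverse Lipschitz on `T`, so the density of `T` is bounded by that of `S` off the cone
  have hle : ∀ s : ℝ, 0 < s → volume (T ∩ Metric.closedBall (p + s • v) (η * s)) /
      volume (Metric.closedBall (p + s • v) (η * s)) ≤
      κ * (μHE[d - 1] (G (R * s)) / ENNReal.ofReal ((R * s) ^ (d - 1))) := by
    intro s hs
    set Q := T ∩ Metric.closedBall (p + s • v) (η * s) with hQ
    have hvol : volume Q ≤ (c : ℝ≥0∞) ^ (d - 1) * μHE[d - 1] (G (R * s)) := by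
      have hinj : InjOn f Q := fun x hx y hy hxy => by
        have := hc x hx.1 y hy.1
        rw [hxy, sub_self, norm_zero, mul_zero] at this
        exact sub_eq_zero.1 (norm_le_zero_iff.1 this)
      have hlip : LipschitzOnWith c (Function.invFunOn f Q) (f '' Q) := by
        refine LipschitzOnWith.of_dist_le_mul ?_
        rintro _ ⟨x, hx, rfl⟩ _ ⟨y, hy, rfl⟩
        rw [hinj.leftInvOn_invFunOn hx, hinj.leftInvOn_invFunOn hy, dist_eq_norm, dist_eq_norm]
        exact hc x hx.1 y hy.1
      have h1 := euclideanHausdorffMeasure_image_le_of_lipschitzOnWith hlip (d - 1)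
      rw [hinj.leftInvOn_invFunOn.image_image, EuclideanSpace.euclideanHausdorffMeasure_eq_volume]
        at h1
      exact h1.trans (by gcongr; exact hmaps s hs)
    rw [Measure.addHaar_closedBall _ _ (by positivity), finrank_euclideanSpace_fin, ← hβ]
    calc volume Q / (ENNReal.ofReal ((η * s) ^ (d - 1)) * β)
        ≤ ((c : ℝ≥0∞) ^ (d - 1) * μHE[d - 1] (G (R * s))) /
          (ENNReal.ofReal ((η * s) ^ (d - 1)) * β) := by gcongr
      _ = _ := by
        have e1 : ENNReal.ofReal ((η * s) ^ (d - 1)) * ENNReal.ofReal ((R / η) ^ (d - 1)) =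
            ENNReal.ofReal ((R * s) ^ (d - 1)) := by
          rw [← ENNReal.ofReal_mul (by positivity), ← mul_pow]
          congr 2; field_simp
        have e2 : ENNReal.ofReal ((η * s) ^ (d - 1)) ≠ 0 := by
          rw [Ne, ENNReal.ofReal_eq_zero, not_le]; positivity
        have e3 : ENNReal.ofReal ((R / η) ^ (d - 1)) ≠ 0 := by
          rw [Ne, ENNReal.ofReal_eq_zero, not_le]; positivity
        have e4 := ENNReal.ofReal_ne_top (r := (R / η) ^ (d - 1))
        rw [hκ, ← e1]
        generalize ENNReal.ofReal ((R / η) ^ (d - 1)) = X at e3 e4 ⊢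
        rw [div_eq_mul_inv, div_eq_mul_inv, div_eq_mul_inv,
          ENNReal.mul_inv (Or.inl e2) (Or.inl ENNReal.ofReal_ne_top),
          ENNReal.mul_inv (Or.inl e2) (Or.inl ENNReal.ofReal_ne_top)]
        calc _ = (c : ℝ≥0∞) ^ (d - 1) * μHE[d - 1] (G (R * s)) *
            ((ENNReal.ofReal ((η * s) ^ (d - 1)))⁻¹ * β⁻¹) * 1 := by rw [mul_one]
          _ = _ := by rw [← ENNReal.mul_inv_cancel e3 e4]; ring
  have hlim : Tendsto (fun s : ℝ => κ * (μHE[d - 1] (G (R * s)) /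
      ENNReal.ofReal ((R * s) ^ (d - 1)))) (𝓝[>] 0) (𝓝 0) := by
    have := ENNReal.Tendsto.const_mul (a := κ) hG0 (Or.inr hκt)
    rwa [mul_zero] at this
  have := le_of_tendsto_of_tendsto hT1 hlim (by
    filter_upwards [self_mem_nhdsWithin] with s hs
    exact hle s hs)
  exact absurd this (by simp)

/-! ### The area factor and almost flat sets -/

/-- A bound between measures on countably many pieces, which may overlap, gives the bound on their
union. -/
theorem restrict_iUnion_le_of_forall_restrict_le {α ι : Type*} [MeasurableSpace α] [Countable ι]
    {μ₁ μ₂ : Measure α} {E : ι → Set α} (hE : ∀ i, MeasurableSet (E i))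
    (h : ∀ i, μ₁.restrict (E i) ≤ μ₂) : μ₁.restrict (⋃ i, E i) ≤ μ₂ := by
  rcases isEmpty_or_nonempty ι with hι | hι
  · simp [Measure.zero_le]
  obtain ⟨φ, hφ⟩ := exists_surjective_nat ι
  rw [← hφ.iUnion_comp, ← iUnion_disjointed]
  have hD : ∀ n, MeasurableSet (disjointed (fun n => E (φ n)) n) :=
    MeasurableSet.disjointed fun n => hE (φ n)
  have hd := disjoint_disjointed (fun n => E (φ n))
  refine Measure.le_iff.2 fun G hG => ?_
  rw [Measure.restrict_apply hG, inter_iUnion, measure_iUnion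
    (fun i j hij => (hd hij).mono inter_subset_right inter_subset_right) fun n => hG.inter (hD n)]
  calc ∑' n, μ₁ (G ∩ disjointed (fun n => E (φ n)) n)
      ≤ ∑' n, μ₂ (G ∩ disjointed (fun n => E (φ n)) n) := by
        refine ENNReal.tsum_le_tsum fun n => ?_
        calc _ = μ₁.restrict (E (φ n)) (G ∩ disjointed (fun n => E (φ n)) n) := by
              rw [Measure.restrict_apply (hG.inter (hD n)), inter_assoc,
                inter_eq_left.2 (disjointed_subset (fun n => E (φ n)) n)]
          _ ≤ _ := h (φ n) _
    _ = μ₂ (⋃ n, G ∩ disjointed (fun n => E (φ n)) n) := (measure_iUnion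
        (fun i j hij => (hd hij).mono inter_subset_right inter_subset_right)
          fun n => hG.inter (hD n)).symm
    _ ≤ μ₂ G := measure_mono (iUnion_subset fun n => inter_subset_left)

/-- The factor by which the linear isomorphism `e` multiplies the area of surface elements with
unit normal `n`. -/
noncomputable def areaFactor {d : ℕ} (e : Eucl d ≃L[ℝ] Eucl d) (n : Eucl d) : ℝ :=
  |(e : Eucl d →L[ℝ] Eucl d).det| *
    ‖ContinuousLinearMap.adjoint (e.symm : Eucl d →L[ℝ] Eucl d) n‖

theorem areaFactor_nonneg {d : ℕ} (e : Eucl d ≃L[ℝ] Eucl d) (n : Eucl d) : 0 ≤ areaFactor e n := by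
  unfold areaFactor; positivity

theorem continuous_areaFactor {d : ℕ} (e : Eucl d ≃L[ℝ] Eucl d) : Continuous (areaFactor e) := by
  unfold areaFactor; fun_prop

theorem adjoint_adjoint_symm {d : ℕ} (e : Eucl d ≃L[ℝ] Eucl d) (n : Eucl d) :
    ContinuousLinearMap.adjoint (e : Eucl d →L[ℝ] Eucl d)
      (ContinuousLinearMap.adjoint (e.symm : Eucl d →L[ℝ] Eucl d) n) = n := by
  refine ext_inner_left ℝ fun v => ?_
  rw [ContinuousLinearMap.adjoint_inner_right]
  exact inner_map_adjoint_symm e v n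

/-- The area factor varies by a relative amount of order `ε` on an `ε`-ball of directions. -/
theorem areaFactor_le_of_norm_sub_le {d : ℕ} (e : Eucl d ≃L[ℝ] Eucl d) {n ν : Eucl d} {ε : ℝ}
    (hn : ‖n‖ = 1) (h : ‖n - ν‖ ≤ ε) :
    areaFactor e ν ≤
      (1 + ‖(e : Eucl d →L[ℝ] Eucl d)‖ * ‖(e.symm : Eucl d →L[ℝ] Eucl d)‖ * ε) *
        areaFactor e n := by
  set P := ContinuousLinearMap.adjoint (e.symm : Eucl d →L[ℝ] Eucl d) with hP
  have hPn : ‖P‖ = ‖(e.symm : Eucl d →L[ℝ] Eucl d)‖ := LinearIsometryEquiv.norm_map _ _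
  have h1 : ‖P ν‖ ≤ ‖P n‖ + ‖(e.symm : Eucl d →L[ℝ] Eucl d)‖ * ε := by
    have h2 : ‖P (n - ν)‖ ≤ ‖P‖ * ‖n - ν‖ := P.le_opNorm _
    have h3 : ‖P ν‖ ≤ ‖P n‖ + ‖P (n - ν)‖ := by
      have := norm_sub_le (P n) (P (n - ν))
      rwa [← map_sub, sub_sub_cancel] at this
    rw [hPn] at h2
    have := mul_le_mul_of_nonneg_left h (norm_nonneg (e.symm : Eucl d →L[ℝ] Eucl d))
    linarith
  have h4 : 1 ≤ ‖(e : Eucl d →L[ℝ] Eucl d)‖ * ‖P n‖ := by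
    have := (ContinuousLinearMap.adjoint (e : Eucl d →L[ℝ] Eucl d)).le_opNorm (P n)
    rwa [hP, adjoint_adjoint_symm, hn, LinearIsometryEquiv.norm_map] at this
  have hε : 0 ≤ ε := (norm_nonneg _).trans h
  have h5 : ‖(e.symm : Eucl d →L[ℝ] Eucl d)‖ * ε * 1 ≤
      ‖(e.symm : Eucl d →L[ℝ] Eucl d)‖ * ε * (‖(e : Eucl d →L[ℝ] Eucl d)‖ * ‖P n‖) :=
    mul_le_mul_of_nonneg_left h4 (by positivity)
  calc areaFactor e ν = |(e : Eucl d →L[ℝ] Eucl d).det| * ‖P ν‖ := rfl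
    _ ≤ |(e : Eucl d →L[ℝ] Eucl d).det| *
        ((1 + ‖(e : Eucl d →L[ℝ] Eucl d)‖ * ‖(e.symm : Eucl d →L[ℝ] Eucl d)‖ * ε) * ‖P n‖) := by
      gcongr
      linarith
    _ = _ := by rw [areaFactor]; ring

/-- An almost flat set has nearly the area factor of the hyperplane `ν^⊥`, by comparison with its
projection `π` to that hyperplane. -/
theorem euclideanHausdorffMeasure_image_le_of_almost_flat {d : ℕ} (e : Eucl d ≃L[ℝ] Eucl d)
    {ν : Eucl d} {ε : ℝ} (hν : ‖ν‖ = 1) (hε : 0 ≤ ε) (hε2 : ε ≤ 1 / 2) {E : Set (Eucl d)}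
    (hE : ∀ x ∈ E, ∀ y ∈ E, |⟪x - y, ν⟫| ≤ ε * ‖x - y‖) :
    (μHE[d - 1] : Measure (Eucl d)) (e '' E) ≤ ENNReal.ofReal
      ((1 + 2 * (‖(e : Eucl d →L[ℝ] Eucl d)‖ * ‖(e.symm : Eucl d →L[ℝ] Eucl d)‖ * ε)) ^ (d - 1) *
        areaFactor e ν) * μHE[d - 1] E := by
  set a := ‖(e : Eucl d →L[ℝ] Eucl d)‖ with ha
  set b := ‖(e.symm : Eucl d →L[ℝ] Eucl d)‖ with hb
  have ha0 : 0 ≤ a := norm_nonneg _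
  have hb0 : 0 ≤ b := norm_nonneg _
  have hν0 : ν ≠ 0 := by rintro rfl; simp at hν
  have hνν : ⟪ν, ν⟫ = 1 := by rw [real_inner_self_eq_norm_sq, hν]; norm_num
  set π : Eucl d → Eucl d := fun x => x - ⟪x, ν⟫ • ν with hπ
  have hπsub : ∀ x y, π x - π y = (x - y) - ⟪x - y, ν⟫ • ν := by
    intro x y; simp only [hπ, inner_sub_left, sub_smul]; abel
  have hπ1 : LipschitzOnWith 1 π E := by
    refine LipschitzOnWith.of_dist_le_mul fun x _ y _ => ?_
    rw [dist_eq_norm, dist_eq_norm, hπsub, NNReal.coe_one, one_mul]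
    refine le_of_sq_le_sq ?_ (norm_nonneg _)
    rw [norm_sub_sq_real, inner_smul_right, norm_smul, hν, mul_one, Real.norm_eq_abs, sq_abs]
    nlinarith [sq_nonneg ⟪x - y, ν⟫]
  have hdist : ∀ x ∈ E, ∀ y ∈ E, ‖x - y‖ ≤ 2 * ‖π x - π y‖ ∧
      ‖e x - e y‖ ≤ (1 + 2 * (a * b * ε)) * ‖e (π x) - e (π y)‖ := by
    intro x hx y hy
    have h1 := hE x hx y hy
    have h0 : x - y = (π x - π y) + ⟪x - y, ν⟫ • ν := by rw [hπsub]; abel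
    have h2 : ‖x - y‖ ≤ ‖π x - π y‖ + |⟪x - y, ν⟫| := by
      have h4 := norm_add_le (π x - π y) (⟪x - y, ν⟫ • ν)
      rw [← h0, norm_smul, hν, mul_one, Real.norm_eq_abs] at h4
      exact h4
    have h3 : ε * ‖x - y‖ ≤ 1 / 2 * ‖x - y‖ := by gcongr
    have h5 : ‖x - y‖ ≤ 2 * ‖π x - π y‖ := by linarith
    refine ⟨h5, ?_⟩
    have h6 : ‖π x - π y‖ ≤ b * ‖e (π x) - e (π y)‖ := by
      have := (e.symm : Eucl d →L[ℝ] Eucl d).le_opNorm (e (π x) - e (π y))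
      simpa using this
    have h7 : e x - e y = (e (π x) - e (π y)) + ⟪x - y, ν⟫ • e ν := by
      rw [← map_sub, h0, map_add, map_sub, map_smul, ← h0]
    have h8 : ‖e ν‖ ≤ a := by
      have := (e : Eucl d →L[ℝ] Eucl d).le_opNorm ν
      rwa [hν, mul_one] at this
    calc ‖e x - e y‖ ≤ ‖e (π x) - e (π y)‖ + |⟪x - y, ν⟫| * ‖e ν‖ := by
          rw [h7]
          refine (norm_add_le _ _).trans ?_
          rw [norm_smul, Real.norm_eq_abs]
      _ ≤ ‖e (π x) - e (π y)‖ + (ε * (2 * (b * ‖e (π x) - e (π y)‖))) * a := by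
          gcongr
          exact h1.trans (by gcongr; linarith)
      _ = _ := by ring
  -- `e '' E` is the image of `e '' (π '' E)` under `e ∘ π⁻¹ ∘ e⁻¹`, which is Lipschitz with
  -- constant close to `1`
  set Q : ℝ≥0 := ⟨1 + 2 * (a * b * ε), by positivity⟩ with hQ
  have hinj : InjOn π E := fun x hx y hy hxy => by
    have := (hdist x hx y hy).1
    rw [hxy, sub_self, norm_zero, mul_zero] at this
    exact sub_eq_zero.1 (norm_le_zero_iff.1 this)
  have hlip : LipschitzOnWith Q (fun z => e (Function.invFunOn π E (e.symm z))) (e '' (π '' E)) := by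
    refine LipschitzOnWith.of_dist_le_mul ?_
    rintro _ ⟨_, ⟨x, hx, rfl⟩, rfl⟩ _ ⟨_, ⟨y, hy, rfl⟩, rfl⟩
    rw [e.symm_apply_apply, e.symm_apply_apply, hinj.leftInvOn_invFunOn hx,
      hinj.leftInvOn_invFunOn hy, dist_eq_norm, dist_eq_norm]
    exact (hdist x hx y hy).2
  have h1 := euclideanHausdorffMeasure_image_le_of_lipschitzOnWith hlip (d - 1)
  have himg : (fun z => e (Function.invFunOn π E (e.symm z))) '' (e '' (π '' E)) = e '' E := by
    ext z
    constructor
    · rintro ⟨_, ⟨_, ⟨x, hx, rfl⟩, rfl⟩, rfl⟩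
      exact ⟨x, hx, by simp [hinj.leftInvOn_invFunOn hx]⟩
    · rintro ⟨x, hx, rfl⟩
      exact ⟨_, ⟨_, ⟨x, hx, rfl⟩, rfl⟩, by simp [hinj.leftInvOn_invFunOn hx]⟩
  rw [himg] at h1
  have h2 := euclideanHausdorffMeasure_image_hyperplane e hν0 0 (F := π '' E) (by
    rintro _ ⟨x, -, rfl⟩
    show ⟪π x - 0, ν⟫ = 0
    rw [sub_zero, hπ, inner_sub_left, inner_smul_left, hνν]; simp)
  rw [h2, hν, div_one] at h1
  have h3 := euclideanHausdorffMeasure_image_le_of_lipschitzOnWith hπ1 (d - 1)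
  rw [ENNReal.coe_one, one_pow, one_mul] at h3
  refine h1.trans ?_
  rw [ENNReal.ofReal_mul (p := (1 + 2 * (a * b * ε)) ^ (d - 1)) (by positivity), mul_assoc,
    ENNReal.ofReal_pow (by positivity)]
  have hQ' : ENNReal.ofReal (1 + 2 * (a * b * ε)) = Q := by
    rw [← ENNReal.ofReal_coe_nnreal]; rfl
  rw [hQ']
  exact mul_le_mul_right (mul_le_mul_right h3 _) _

/-! ### The upper bound in the area formula -/

/-- The constant of the comparison of areas on pieces that are flat up to `ε`; it tends to `1`
with `ε → 0`. -/
noncomputable def flatConst {d : ℕ} (e : Eucl d ≃L[ℝ] Eucl d) (ε : ℝ) : ℝ≥0∞ :=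
  ENNReal.ofReal
    ((1 + 2 * (‖(e : Eucl d →L[ℝ] Eucl d)‖ * ‖(e.symm : Eucl d →L[ℝ] Eucl d)‖ * ε)) ^ (d - 1) *
      (1 + ‖(e : Eucl d →L[ℝ] Eucl d)‖ * ‖(e.symm : Eucl d →L[ℝ] Eucl d)‖ * ε))

theorem map_symm_apply {d k : ℕ} (e : Eucl d ≃L[ℝ] Eucl d) (G : Set (Eucl d)) :
    (μHE[k] : Measure (Eucl d)).map e.symm G = μHE[k] (e '' G) := by
  have : MeasurableEmbedding (e.symm : Eucl d → Eucl d) :=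
    e.symm.toHomeomorph.measurableEmbedding
  rw [this.map_apply, e.image_eq_preimage_symm]

theorem euclideanHausdorffMeasure_image_eq_zero {d k : ℕ} (e : Eucl d ≃L[ℝ] Eucl d)
    {G : Set (Eucl d)} (hG : (μHE[k] : Measure (Eucl d)) G = 0) :
    (μHE[k] : Measure (Eucl d)) (e '' G) = 0 := by
  have := euclideanHausdorffMeasure_image_le_of_lipschitzOnWith
    ((e : Eucl d →L[ℝ] Eucl d).lipschitz.lipschitzOnWith (s := G)) k
  rw [hG, mul_zero] at this
  exact le_antisymm this bot_le

theorem restrict_map_symm_le_of_almost_flat {d : ℕ} (e : Eucl d ≃L[ℝ] Eucl d) {S E : Set (Eucl d)}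
    {n : Eucl d → Eucl d} {ν : Eucl d} {ε : ℝ} (hν : ‖ν‖ = 1) (hε : 0 ≤ ε) (hε2 : ε ≤ 1 / 2)
    (hEm : MeasurableSet E) (hES : E ⊆ S) (hn : ∀ x ∈ E, ‖n x‖ = 1 ∧ ‖n x - ν‖ ≤ ε)
    (hE : ∀ x ∈ E, ∀ y ∈ E, |⟪x - y, ν⟫| ≤ ε * ‖x - y‖) :
    ((μHE[d - 1] : Measure (Eucl d)).map e.symm).restrict E ≤ flatConst e ε •
      ((μHE[d - 1] : Measure (Eucl d)).restrict S).withDensity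
        fun x => ENNReal.ofReal (areaFactor e (n x)) := by
  refine Measure.le_iff.2 fun G hG => ?_
  rw [Measure.restrict_apply hG, map_symm_apply, Measure.smul_apply, smul_eq_mul]
  set κ := ‖(e : Eucl d →L[ℝ] Eucl d)‖ * ‖(e.symm : Eucl d →L[ℝ] Eucl d)‖ with hκ
  have hκ0 : 0 ≤ κ := by positivity
  have hq : 0 ≤ (1 + 2 * (κ * ε)) ^ (d - 1) := by positivity
  refine (euclideanHausdorffMeasure_image_le_of_almost_flat e hν hε hε2
    fun x hx y hy => hE x hx.2 y hy.2).trans ?_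
  calc ENNReal.ofReal ((1 + 2 * (κ * ε)) ^ (d - 1) * areaFactor e ν) * μHE[d - 1] (G ∩ E)
      = ∫⁻ _ in G ∩ E, ENNReal.ofReal ((1 + 2 * (κ * ε)) ^ (d - 1) * areaFactor e ν)
          ∂μHE[d - 1] := (setLIntegral_const _ _).symm
    _ ≤ ∫⁻ x in G ∩ E, flatConst e ε * ENNReal.ofReal (areaFactor e (n x)) ∂μHE[d - 1] := by
        refine setLIntegral_mono' (hG.inter hEm) fun x hx => ?_
        change _ ≤ ENNReal.ofReal ((1 + 2 * (κ * ε)) ^ (d - 1) * (1 + κ * ε)) * _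
        rw [← ENNReal.ofReal_mul (by positivity), mul_assoc (_ ^ (d - 1))]
        refine ENNReal.ofReal_le_ofReal ?_
        exact mul_le_mul_of_nonneg_left
          (areaFactor_le_of_norm_sub_le e (hn x hx.2).1 (hn x hx.2).2) hq
    _ = flatConst e ε * ∫⁻ x in G ∩ E, ENNReal.ofReal (areaFactor e (n x)) ∂μHE[d - 1] :=
        lintegral_const_mul' _ _ ENNReal.ofReal_ne_top
    _ ≤ _ := by
        gcongr
        rw [withDensity_apply _ hG, Measure.restrict_restrict hG]
        exact lintegral_mono_set (inter_subset_inter_right G hES)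

/-- The part of `S` that is parametrized by a piece `T` on which `f` is close to an injective linear
map is almost flat. -/
theorem restrict_map_symm_le_of_approximatesLinearOn {d : ℕ} (e : Eucl d ≃L[ℝ] Eucl d)
    {f : Eucl (d - 1) → Eucl d} {C : ℝ≥0} (hf : LipschitzWith C f) {T : Set (Eucl (d - 1))}
    {A : Eucl (d - 1) →L[ℝ] Eucl d} {r c : ℝ≥0} {ε : ℝ} (hε : 0 < ε) (hε2 : ε ≤ 1 / 2)
    (hT : MeasurableSet T) (hA : ApproximatesLinearOn f A T r) (hc : AntilipschitzWith c A)
    (hrc : 4 * (r * c : ℝ) ≤ ε / 2) {S : Set (Eucl d)} (hTS : f '' T ⊆ S) {n : Eucl d → Eucl d}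
    (hn : ∀ p ∈ T, IsUnitNormalAt S (f p) (n (f p))) {ν : Eucl d}
    (hν : ∀ p ∈ T, ‖n (f p) - ν‖ ≤ ε / 4) :
    MeasurableSet (f '' T) ∧
    ((μHE[d - 1] : Measure (Eucl d)).map e.symm).restrict (f '' T) ≤ flatConst e ε •
      ((μHE[d - 1] : Measure (Eucl d)).restrict S).withDensity
        fun x => ENNReal.ofReal (areaFactor e (n x)) := by
  have hanti : ∀ x ∈ T, ∀ y ∈ T, ‖x - y‖ ≤ ((2 * c : ℝ≥0) : ℝ) * ‖f x - f y‖ := by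
    intro x hx y hy
    have h1 : ‖x - y‖ ≤ c * ‖A (x - y)‖ := by
      simpa [dist_eq_norm] using hc.le_mul_dist x y
    have h2 : ‖A (x - y)‖ ≤ ‖f x - f y‖ + r * ‖x - y‖ := by
      have h3 := norm_sub_le (f x - f y) (f x - f y - A (x - y))
      rw [sub_sub_cancel] at h3
      exact h3.trans (by linarith [hA x hx y hy])
    have h4 : (c : ℝ) * ‖A (x - y)‖ ≤ c * (‖f x - f y‖ + r * ‖x - y‖) := by gcongr
    have h5 : (r * c : ℝ) * ‖x - y‖ ≤ 1 / 2 * ‖x - y‖ := by gcongr; linarith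
    push_cast
    nlinarith
  have hinj : InjOn f T := fun x hx y hy hxy => by
    have := hanti x hx y hy
    rw [hxy, sub_self, norm_zero, mul_zero] at this
    exact sub_eq_zero.1 (norm_le_zero_iff.1 this)
  have himg : ∀ T' ⊆ T, MeasurableSet T' → MeasurableSet (f '' T') := fun T' h h' =>
    h'.image_of_continuousOn_injOn hf.continuous.continuousOn (hinj.mono h)
  refine ⟨himg T Subset.rfl hT, ?_⟩
  have hae := ae_abs_inner_le_of_approximatesLinearOn hT hA hanti hTS
  rw [ae_restrict_iff' hT, ae_iff] at hae
  -- remove the parameters in a Borel null set `N` containing the exceptional ones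
  set N := toMeasurable volume {p | ¬(p ∈ T → ∀ n, IsUnitNormalAt S (f p) n →
    ∀ v, |⟪A v, n⟫| ≤ r * ‖v‖)} with hN
  have hN0 : volume N = 0 := by rw [hN, measure_toMeasurable, hae]
  have hNm : MeasurableSet N := measurableSet_toMeasurable _ _
  have hgood : ∀ p ∈ T \ N, ∀ v, |⟪A v, n (f p)⟫| ≤ r * ‖v‖ := by
    rintro p ⟨hpT, hpN⟩
    by_contra h
    exact hpN (subset_toMeasurable _ _ fun h' => h (h' hpT _ (hn p hpT)))
  have hnull : (μHE[d - 1] : Measure (Eucl d)) (f '' (T ∩ N)) = 0 := by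
    have := euclideanHausdorffMeasure_image_le_of_lipschitzOnWith
      (hf.lipschitzOnWith (s := T ∩ N)) (d - 1)
    rw [EuclideanSpace.euclideanHausdorffMeasure_eq_volume,
      measure_mono_null inter_subset_right hN0, mul_zero] at this
    exact le_antisymm this bot_le
  have hE : MeasurableSet (f '' (T \ N)) := himg _ sdiff_subset (hT.diff hNm)
  have hcongr : ((μHE[d - 1] : Measure (Eucl d)).map e.symm).restrict (f '' T) =
      ((μHE[d - 1] : Measure (Eucl d)).map e.symm).restrict (f '' (T \ N)) := by
    refine Measure.restrict_congr_set ?_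
    refine (ae_le_set.2 ?_).antisymm (LE.le.eventuallyLE (image_mono sdiff_subset))
    rw [map_symm_apply]
    refine euclideanHausdorffMeasure_image_eq_zero e (measure_mono_null ?_ hnull)
    rintro _ ⟨⟨p, hp, rfl⟩, hp'⟩
    refine ⟨p, ⟨hp, ?_⟩, rfl⟩
    by_contra h
    exact hp' ⟨p, ⟨hp, h⟩, rfl⟩
  rw [hcongr]
  rcases (T \ N).eq_empty_or_nonempty with he | ⟨p₀, hp₀⟩
  · simp [he, Measure.zero_le]
  have hclose : ∀ p ∈ T \ N, ‖n (f p) - n (f p₀)‖ ≤ ε / 2 := by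
    intro p hp
    have h1 := hν p hp.1
    have h2 := hν p₀ hp₀.1
    calc ‖n (f p) - n (f p₀)‖ = ‖(n (f p) - ν) - (n (f p₀) - ν)‖ := by rw [sub_sub_sub_cancel_right]
      _ ≤ _ := (norm_sub_le _ _).trans (by linarith)
  refine restrict_map_symm_le_of_almost_flat e (hn p₀ hp₀.1).1 hε.le hε2 hE
    ((image_mono sdiff_subset).trans hTS) ?_ ?_
  · rintro _ ⟨p, hp, rfl⟩
    exact ⟨(hn p hp.1).1, (hclose p hp).trans (by linarith)⟩
  · rintro _ ⟨p, hp, rfl⟩ _ ⟨q, hq, rfl⟩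
    have h1 : |⟪f p - f q, n (f p)⟫| ≤ 2 * r * ‖p - q‖ := by
      have h2 : |⟪f p - f q - A (p - q), n (f p)⟫| ≤ r * ‖p - q‖ := by
        refine (abs_real_inner_le_norm _ _).trans ?_
        rw [(hn p hp.1).1, mul_one]
        exact hA p hp.1 q hq.1
      have h3 := hgood p hp (p - q)
      have h4 : ⟪f p - f q, n (f p)⟫ =
          ⟪f p - f q - A (p - q), n (f p)⟫ + ⟪A (p - q), n (f p)⟫ := by
        rw [inner_sub_left (f p - f q)]; ring
      rw [h4]
      exact (abs_add_le _ _).trans (by linarith)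
    have h5 : |⟪f p - f q, n (f p) - n (f p₀)⟫| ≤ ‖f p - f q‖ * (ε / 2) :=
      (abs_real_inner_le_norm _ _).trans (by gcongr; exact hclose p hp)
    have h6 := hanti p hp.1 q hq.1
    push_cast at h6
    have h7 : 2 * r * ‖p - q‖ ≤ ε / 2 * ‖f p - f q‖ := by
      calc 2 * (r : ℝ) * ‖p - q‖ ≤ 2 * r * (2 * c * ‖f p - f q‖) := by gcongr
        _ = (4 * (r * c : ℝ)) * ‖f p - f q‖ := by ring
        _ ≤ _ := by gcongr
    have h8 : ⟪f p - f q, n (f p₀)⟫ =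
        ⟪f p - f q, n (f p)⟫ - ⟪f p - f q, n (f p) - n (f p₀)⟫ := by
      rw [inner_sub_right]; ring
    rw [h8]
    exact (abs_sub _ _).trans (by linarith)

/-- The upper bound for the part of the surface lying on one Lipschitz image, where the
parametrization is an immersion. -/
theorem restrict_map_symm_le_of_lipschitzWith {d : ℕ} (e : Eucl d ≃L[ℝ] Eucl d)
    {f : Eucl (d - 1) → Eucl d} {C : ℝ≥0} (hf : LipschitzWith C f) {ε : ℝ} (hε : 0 < ε)
    (hε2 : ε ≤ 1 / 2) {S S' : Set (Eucl d)} (hS' : MeasurableSet S') (hSS : S' ⊆ S)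
    {n n' : Eucl d → Eucl d} (hn' : Measurable n')
    (hnn : ∀ x ∈ S', n x = n' x) (hn : ∀ x ∈ S', IsUnitNormalAt S x (n x)) :
    MeasurableSet (f '' {p | f p ∈ S' ∧ DifferentiableAt ℝ f p ∧
      Function.Injective (fderiv ℝ f p)}) ∧
    ((μHE[d - 1] : Measure (Eucl d)).map e.symm).restrict (f '' {p | f p ∈ S' ∧
      DifferentiableAt ℝ f p ∧ Function.Injective (fderiv ℝ f p)}) ≤ flatConst e ε •
      ((μHE[d - 1] : Measure (Eucl d)).restrict S).withDensity
        fun x => ENNReal.ofReal (areaFactor e (n x)) := by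
  set T := {p | f p ∈ S' ∧ DifferentiableAt ℝ f p ∧ Function.Injective (fderiv ℝ f p)} with hT
  have hTm : MeasurableSet T := by
    refine (hf.continuous.measurable hS').inter
      ((measurableSet_of_differentiableAt ℝ f).inter ?_)
    exact measurable_fderiv ℝ f (ContinuousLinearMap.isOpen_injective (𝕜 := ℝ)).measurableSet
  have hr : ∀ A : Eucl (d - 1) →L[ℝ] Eucl d, ∃ r : ℝ≥0, r ≠ 0 ∧ (Function.Injective A →
      ∃ c : ℝ≥0, AntilipschitzWith c A ∧ 4 * (r * c : ℝ) ≤ ε / 2) := by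
    intro A
    by_cases hA : Function.Injective A
    · obtain ⟨c, hc0, hc⟩ := (A : Eucl (d - 1) →ₗ[ℝ] Eucl d).exists_antilipschitzWith
        (LinearMap.ker_eq_bot.2 hA)
      refine ⟨⟨ε / (8 * c), by positivity⟩, ?_, fun _ => ⟨c, hc, ?_⟩⟩
      · intro h
        have : ε / (8 * c) = 0 := congrArg NNReal.toReal h
        have h0 : (0 : ℝ) < c := hc0
        have : 0 < ε / (8 * c) := by positivity
        linarith
      · have h0 : (0 : ℝ) < c := hc0
        show 4 * (ε / (8 * c) * c) ≤ ε / 2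
        apply le_of_eq
        field_simp
        norm_num
    · exact ⟨1, one_ne_zero, fun h => (hA h).elim⟩
  choose r hr0 hr using hr
  obtain ⟨t, A, -, htm, hcov, happ, hA⟩ :=
    exists_partition_approximatesLinearOn_of_hasFDerivWithinAt f T (fderiv ℝ f)
      (fun x hx => hx.2.1.hasFDerivAt.hasFDerivWithinAt) r hr0
  -- cut `T` further into countably many pieces on which the normal is nearly constant
  set D := TopologicalSpace.denseSeq (Eucl d) with hD
  set P : ℕ × ℕ → Set (Eucl (d - 1)) := fun i =>
    T ∩ t i.1 ∩ {p | ‖n' (f p) - D i.2‖ ≤ ε / 4} with hP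
  have hPm : ∀ i, MeasurableSet (P i) := fun i => by
    refine (hTm.inter (htm i.1)).inter (measurableSet_le ?_ measurable_const)
    exact ((hn'.comp hf.continuous.measurable).sub_const _).norm
  have hTU : f '' T = ⋃ i, f '' P i := by
    rw [← image_iUnion]
    congr 1
    refine Subset.antisymm (fun p hp => ?_)
      (iUnion_subset fun i => inter_subset_left.trans inter_subset_left)
    obtain ⟨j, hj⟩ := mem_iUnion.1 (hcov hp)
    obtain ⟨m, hm⟩ := (TopologicalSpace.denseRange_denseSeq (Eucl d)).exists_dist_lt (n' (f p))
      (show 0 < ε / 4 by positivity)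
    rw [dist_eq_norm] at hm
    exact mem_iUnion.2 ⟨(j, m), ⟨hp, hj⟩, hm.le⟩
  have hpiece : ∀ i, MeasurableSet (f '' P i) ∧
      ((μHE[d - 1] : Measure (Eucl d)).map e.symm).restrict (f '' P i) ≤ flatConst e ε •
      ((μHE[d - 1] : Measure (Eucl d)).restrict S).withDensity
        fun x => ENNReal.ofReal (areaFactor e (n x)) := by
    intro i
    rcases T.eq_empty_or_nonempty with hTe | hTn
    · simp [hP, hTe, Measure.zero_le]
    obtain ⟨y, hy, hAy⟩ := hA hTn i.1
    obtain ⟨c, hc, hrc⟩ := hr (A i.1) (by rw [hAy]; exact hy.2.2)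
    refine restrict_map_symm_le_of_approximatesLinearOn e hf hε hε2 (hPm i)
      ((happ i.1).mono_set inter_subset_left) hc hrc (ν := D i.2) ?_ ?_ ?_
    · rintro _ ⟨p, hp, rfl⟩
      exact hSS hp.1.1.1
    · exact fun p hp => hn _ hp.1.1.1
    · intro p hp
      rw [hnn _ hp.1.1.1]
      exact hp.2
  rw [hTU]
  exact ⟨MeasurableSet.iUnion fun i => (hpiece i).1,
    restrict_iUnion_le_of_forall_restrict_le (fun i => (hpiece i).1) fun i => (hpiece i).2⟩

/-- Upper bound in the area formula for a linear isomorphism. The measure `G ↦ μHE (e '' G)` is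
written as the image of `μHE` under `e⁻¹`. -/
theorem restrict_map_symm_le {d : ℕ} (e : Eucl d ≃L[ℝ] Eucl d) {S : OrientedSet d}
    (hS : IsOrientedSurface S) :
    ((μHE[d - 1] : Measure (Eucl d)).map e.symm).restrict S.carrier ≤
      ((μHE[d - 1] : Measure (Eucl d)).restrict S.carrier).withDensity
        fun x => ENNReal.ofReal (areaFactor e (S.normal x)) := by
  -- `S'` is a Borel part of full measure that is covered by the Lipschitz images and on which the
  -- normal field is an approximate normal and agrees with a Borel field
  obtain ⟨S₀, hS₀S, hS₀m, hS₀⟩ := hS.nullMeasurable.exists_measurable_subset_ae_eq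
  obtain ⟨f, hf, hfnull⟩ := hS.rectifiable
  choose C hf using hf
  set n' := hS.measurable_normal.mk with hn'
  have hae := hS.measurable_normal.ae_eq_mk.and hS.isUnitNormal
  rw [ae_restrict_iff'₀ hS.nullMeasurable, ae_iff] at hae
  set N₁ := toMeasurable μHE[d - 1] {x | ¬(x ∈ S.carrier → S.normal x = n' x ∧
    IsUnitNormalAt S.carrier x (S.normal x))} with hN₁
  have hN₁0 : μHE[d - 1] N₁ = 0 := by rw [hN₁, measure_toMeasurable]; exact hae
  set N₂ := toMeasurable μHE[d - 1] (S.carrier \ ⋃ i, range (f i)) with hN₂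
  have hN₂0 : μHE[d - 1] N₂ = 0 := by rw [hN₂, measure_toMeasurable]; exact hfnull
  set S' := S₀ \ (N₁ ∪ N₂) with hS'
  have hS'm : MeasurableSet S' :=
    hS₀m.diff ((measurableSet_toMeasurable _ _).union (measurableSet_toMeasurable _ _))
  have hS'S : S' ⊆ S.carrier := sdiff_subset.trans hS₀S
  have hgood : ∀ x ∈ S', S.normal x = n' x ∧ IsUnitNormalAt S.carrier x (S.normal x) := by
    intro x hx
    by_contra h
    exact hx.2 (Or.inl (subset_toMeasurable _ _ fun h' => h (h' (hS'S hx))))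
  have hcov : S' ⊆ ⋃ i, range (f i) := by
    intro x hx
    by_contra h
    exact hx.2 (Or.inr (subset_toMeasurable _ _ ⟨hS'S hx, h⟩))
  set G : ℕ → Set (Eucl d) := fun j => f j '' {p | f j p ∈ S' ∧ DifferentiableAt ℝ (f j) p ∧
      Function.Injective (fderiv ℝ (f j) p)} with hG
  have hGS : ⋃ j, G j ⊆ S.carrier := by
    refine iUnion_subset fun j => ?_
    rintro _ ⟨p, hp, rfl⟩
    exact hS'S hp.1
  -- what the immersed parts miss is null: points of non-differentiability by Rademacher, points
  -- where the differential is not injective by the Sard-type lemma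
  have hGnull : μHE[d - 1] (S.carrier \ ⋃ j, G j) = 0 := by
    have h1 : S.carrier \ ⋃ j, G j ⊆ (S.carrier \ S₀) ∪ (N₁ ∪ N₂) ∪
        ((⋃ j, f j '' {p | ¬ DifferentiableAt ℝ (f j) p}) ∪
          ⋃ j, f j '' {p | DifferentiableAt ℝ (f j) p ∧
            ¬ Function.Injective (fderiv ℝ (f j) p)}) := by
      rintro x ⟨hxS, hxG⟩
      by_cases hx : x ∈ S'
      · obtain ⟨j, p, rfl⟩ := mem_iUnion.1 (hcov hx)
        right
        by_cases hd : DifferentiableAt ℝ (f j) p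
        · refine Or.inr (mem_iUnion.2 ⟨j, p, ⟨hd, fun hi => ?_⟩, rfl⟩)
          exact hxG (mem_iUnion.2 ⟨j, p, ⟨hx, hd, hi⟩, rfl⟩)
        · exact Or.inl (mem_iUnion.2 ⟨j, p, hd, rfl⟩)
      · left
        by_cases hx0 : x ∈ S₀
        · right
          by_contra h
          exact hx ⟨hx0, h⟩
        · exact Or.inl ⟨hxS, hx0⟩
    refine measure_mono_null h1 (measure_union_null (measure_union_null ?_
      (measure_union_null hN₁0 hN₂0)) (measure_union_null ?_ ?_))
    · exact ae_le_set.1 hS₀.symm.le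
    · refine measure_iUnion_null fun j => ?_
      have h2 := euclideanHausdorffMeasure_image_le_of_lipschitzOnWith
        ((hf j).lipschitzOnWith (s := {p | ¬ DifferentiableAt ℝ (f j) p})) (d - 1)
      have h3 : volume {p | ¬ DifferentiableAt ℝ (f j) p} = 0 :=
        ae_iff.1 ((hf j).ae_differentiableAt (μ := volume))
      rw [EuclideanSpace.euclideanHausdorffMeasure_eq_volume, h3, mul_zero] at h2
      exact le_antisymm h2 bot_le
    · exact measure_iUnion_null fun j =>
        euclideanHausdorffMeasure_image_of_not_injective_fderiv (f j)
  have hcongr : ((μHE[d - 1] : Measure (Eucl d)).map e.symm).restrict S.carrier =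
      ((μHE[d - 1] : Measure (Eucl d)).map e.symm).restrict (⋃ j, G j) := by
    refine Measure.restrict_congr_set ?_
    refine (ae_le_set.2 ?_).antisymm (LE.le.eventuallyLE hGS)
    rw [map_symm_apply]
    exact euclideanHausdorffMeasure_image_eq_zero e hGnull
  set m₂ := ((μHE[d - 1] : Measure (Eucl d)).restrict S.carrier).withDensity
        fun x => ENNReal.ofReal (areaFactor e (S.normal x)) with hm₂
  have hε : ∀ ε : ℝ, 0 < ε → ε ≤ 1 / 2 →
      ((μHE[d - 1] : Measure (Eucl d)).map e.symm).restrict S.carrier ≤ flatConst e ε • m₂ := by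
    intro ε h0 h1
    rw [hcongr]
    have h2 := fun j => restrict_map_symm_le_of_lipschitzWith e (hf j) h0 h1 hS'm hS'S
      hS.measurable_normal.measurable_mk (fun x hx => (hgood x hx).1) fun x hx => (hgood x hx).2
    exact restrict_iUnion_le_of_forall_restrict_le (fun j => (h2 j).1) fun j => (h2 j).2
  refine Measure.le_iff.2 fun B _ => ?_
  have hlim : Tendsto (fun ε => flatConst e ε) (𝓝[>] 0) (𝓝 1) := by
    have h1 : Continuous fun ε => flatConst e ε := by
      unfold flatConst
      exact ENNReal.continuous_ofReal.comp (by fun_prop)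
    have h2 := (h1.tendsto 0).mono_left (nhdsWithin_le_nhds (s := Ioi 0))
    simpa [flatConst] using h2
  have hlim2 : Tendsto (fun ε => flatConst e ε * m₂ B) (𝓝[>] 0) (𝓝 (1 * m₂ B)) :=
    ENNReal.Tendsto.mul_const hlim (Or.inl one_ne_zero)
  rw [one_mul] at hlim2
  refine ge_of_tendsto hlim2 ?_
  filter_upwards [Ioc_mem_nhdsGT (show (0 : ℝ) < 1 / 2 by norm_num)] with ε h
  exact hε ε h.1 h.2 B

/-! ### Conormals and images of oriented surfaces under diffeomorphisms -/

theorem inverse_adjoint_equiv {d : ℕ} (e : Eucl d ≃L[ℝ] Eucl d) :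
    (ContinuousLinearMap.adjoint (e : Eucl d →L[ℝ] Eucl d)).inverse =
      ContinuousLinearMap.adjoint (e.symm : Eucl d →L[ℝ] Eucl d) := by
  refine ContinuousLinearMap.inverse_eq ?_ ?_
  · ext1 n
    exact adjoint_adjoint_symm e n
  · ext1 n
    exact adjoint_adjoint_symm e.symm n

theorem conormal_equiv {d : ℕ} (e : Eucl d ≃L[ℝ] Eucl d) (n : Eucl d) :
    conormal (e : Eucl d →L[ℝ] Eucl d) n =
      (‖n‖ / ‖ContinuousLinearMap.adjoint (e.symm : Eucl d →L[ℝ] Eucl d) n‖) •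
        ContinuousLinearMap.adjoint (e.symm : Eucl d →L[ℝ] Eucl d) n := by
  rw [conormal, inverse_adjoint_equiv]

/-- The factor `|n| / |(e⁻¹)ᵀ n|` by which `conormal e n` differs from `(e⁻¹)ᵀ n`. -/
noncomputable def conormalScale {d : ℕ} (e : Eucl d ≃L[ℝ] Eucl d) (n : Eucl d) : ℝ :=
  ‖n‖ / ‖ContinuousLinearMap.adjoint (e.symm : Eucl d →L[ℝ] Eucl d) n‖

theorem conormalScale_nonneg {d : ℕ} (e : Eucl d ≃L[ℝ] Eucl d) (n : Eucl d) :
    0 ≤ conormalScale e n := by unfold conormalScale; positivity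

theorem conormalScale_pos {d : ℕ} (e : Eucl d ≃L[ℝ] Eucl d) {n : Eucl d} (hn : n ≠ 0) :
    0 < conormalScale e n :=
  div_pos (norm_pos_iff.2 hn) (norm_pos_iff.2 (adjoint_symm_ne_zero e hn))

theorem conormal_eq_smul {d : ℕ} (e : Eucl d ≃L[ℝ] Eucl d) (n : Eucl d) :
    conormal (e : Eucl d →L[ℝ] Eucl d) n =
      conormalScale e n • ContinuousLinearMap.adjoint (e.symm : Eucl d →L[ℝ] Eucl d) n :=
  conormal_equiv e n

theorem areaFactor_mul_conormalScale {d : ℕ} (e : Eucl d ≃L[ℝ] Eucl d) {n : Eucl d}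
    (hn : ‖n‖ = 1) :
    areaFactor e n * conormalScale e n = |(e : Eucl d →L[ℝ] Eucl d).det| := by
  have hn0 : n ≠ 0 := by rintro rfl; simp at hn
  have := norm_pos_iff.2 (adjoint_symm_ne_zero e hn0)
  rw [areaFactor, conormalScale, hn]
  field_simp

theorem norm_conormal {d : ℕ} (e : Eucl d ≃L[ℝ] Eucl d) (n : Eucl d) :
    ‖conormal (e : Eucl d →L[ℝ] Eucl d) n‖ = ‖n‖ := by
  rcases eq_or_ne n 0 with rfl | hn
  · simp [conormal]
  · have := norm_pos_iff.2 (adjoint_symm_ne_zero e hn)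
    rw [conormal_equiv, norm_smul, norm_div, norm_norm, norm_norm, div_mul_cancel₀ _ this.ne']

theorem adjoint_conormal {d : ℕ} (e : Eucl d ≃L[ℝ] Eucl d) (n : Eucl d) :
    ContinuousLinearMap.adjoint (e : Eucl d →L[ℝ] Eucl d)
      (conormal (e : Eucl d →L[ℝ] Eucl d) n) = conormalScale e n • n := by
  rw [conormal_eq_smul, map_smul, adjoint_adjoint_symm]

theorem inner_map_conormal {d : ℕ} (e : Eucl d ≃L[ℝ] Eucl d) (v n : Eucl d) :
    ⟪e v, conormal (e : Eucl d →L[ℝ] Eucl d) n⟫ = conormalScale e n * ⟪v, n⟫ := by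
  rw [conormal_eq_smul, inner_smul_right, inner_map_adjoint_symm]

theorem conormal_trans {d : ℕ} (e f : Eucl d ≃L[ℝ] Eucl d) (n : Eucl d) :
    conormal (f : Eucl d →L[ℝ] Eucl d) (conormal (e : Eucl d →L[ℝ] Eucl d) n) =
      conormal (e.trans f : Eucl d →L[ℝ] Eucl d) n := by
  rcases eq_or_ne n 0 with rfl | hn
  · simp [conormal]
  have h1 : ContinuousLinearMap.adjoint ((e.trans f).symm : Eucl d →L[ℝ] Eucl d) n =
      ContinuousLinearMap.adjoint (f.symm : Eucl d →L[ℝ] Eucl d)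
        (ContinuousLinearMap.adjoint (e.symm : Eucl d →L[ℝ] Eucl d) n) := by
    rw [← ContinuousLinearMap.comp_apply, ← ContinuousLinearMap.adjoint_comp]
    rfl
  have hs := conormalScale_pos e hn
  rw [conormal_equiv f, norm_conormal, conormal_eq_smul, map_smul, conormal_equiv (e.trans f), h1,
    norm_smul, Real.norm_eq_abs, abs_of_pos hs, smul_smul]
  congr 1
  have := norm_pos_iff.2 (adjoint_symm_ne_zero f (adjoint_symm_ne_zero e hn))
  field_simp

theorem conormal_refl {d : ℕ} (n : Eucl d) :
    conormal (ContinuousLinearEquiv.refl ℝ (Eucl d) : Eucl d →L[ℝ] Eucl d) n = n := by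
  rcases eq_or_ne n 0 with rfl | hn
  · simp [conormal]
  have h : ContinuousLinearMap.adjoint
      ((ContinuousLinearEquiv.refl ℝ (Eucl d)).symm : Eucl d →L[ℝ] Eucl d) n = n := by
    simp [ContinuousLinearMap.adjoint_id]
  rw [conormal_equiv, h, div_self (norm_ne_zero_iff.2 hn), one_smul]

theorem continuous_conormal {d : ℕ} (e : Eucl d ≃L[ℝ] Eucl d) :
    Continuous (conormal (e : Eucl d →L[ℝ] Eucl d)) := by
  refine continuous_iff_continuousAt.2 fun n => ?_
  rcases eq_or_ne n 0 with rfl | hn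
  · have h0 : conormal (e : Eucl d →L[ℝ] Eucl d) 0 = 0 := by simp [conormal]
    rw [ContinuousAt, h0]
    refine squeeze_zero_norm (fun n => (norm_conormal e n).le) ?_
    simpa using (continuous_norm (E := Eucl d)).tendsto 0
  · have h0 : Continuous (ContinuousLinearMap.adjoint (e.symm : Eucl d →L[ℝ] Eucl d)) :=
      ContinuousLinearMap.continuous _
    have h1 := (continuous_norm.continuousAt.div h0.norm.continuousAt
      (norm_ne_zero_iff.2 (adjoint_symm_ne_zero e hn))).smul h0.continuousAt
    exact h1.congr (Eventually.of_forall fun n => (conormal_equiv e n).symm)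

/-- Bilipschitz `C¹` diffeomorphisms of `ℝ^d`. They preserve oriented surfaces, and both affine
isomorphisms and small deformations by test fields are of this kind. -/
structure IsBilipDiffeo {d : ℕ} (φ : Eucl d → Eucl d) : Prop where
  bijective : Function.Bijective φ
  contDiff : ContDiff ℝ 1 φ
  lipschitz : ∃ C, LipschitzWith C φ
  antilipschitz : ∃ c, AntilipschitzWith c φ
  isInvertible : ∀ x, (fderiv ℝ φ x).IsInvertible

namespace IsBilipDiffeo

variable {d : ℕ} {φ ψ : Eucl d → Eucl d}

theorem invFun_apply (hφ : IsBilipDiffeo φ) (x : Eucl d) : Function.invFun φ (φ x) = x :=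
  Function.leftInverse_invFun hφ.bijective.1 x

theorem apply_invFun (hφ : IsBilipDiffeo φ) (y : Eucl d) : φ (Function.invFun φ y) = y :=
  Function.rightInverse_invFun hφ.bijective.2 y

theorem lipschitz_invFun (hφ : IsBilipDiffeo φ) : ∃ c, LipschitzWith c (Function.invFun φ) := by
  obtain ⟨c, hc⟩ := hφ.antilipschitz
  exact ⟨c, hc.to_rightInverse hφ.apply_invFun⟩

/-- The underlying homeomorphism. -/
noncomputable def toHomeomorph (hφ : IsBilipDiffeo φ) : Eucl d ≃ₜ Eucl d where
  toFun := φ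
  invFun := Function.invFun φ
  left_inv := hφ.invFun_apply
  right_inv := hφ.apply_invFun
  continuous_toFun := hφ.contDiff.continuous
  continuous_invFun := hφ.lipschitz_invFun.choose_spec.continuous

theorem measure_image_eq_zero (hφ : IsBilipDiffeo φ) {k : ℕ} {N : Set (Eucl d)}
    (hN : (μHE[k] : Measure (Eucl d)) N = 0) : (μHE[k] : Measure (Eucl d)) (φ '' N) = 0 := by
  obtain ⟨C, hC⟩ := hφ.lipschitz
  have := euclideanHausdorffMeasure_image_le_of_lipschitzOnWith (hC.lipschitzOnWith (s := N)) k
  rw [hN, mul_zero] at this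
  exact le_antisymm this bot_le

theorem image_eq_preimage (hφ : IsBilipDiffeo φ) (s : Set (Eucl d)) :
    φ '' s = Function.invFun φ ⁻¹' s :=
  hφ.toHomeomorph.image_eq_preimage_symm s

theorem quasiMeasurePreserving_invFun (hφ : IsBilipDiffeo φ) (k : ℕ) (S : Set (Eucl d)) :
    Measure.QuasiMeasurePreserving (Function.invFun φ)
      ((μHE[k] : Measure (Eucl d)).restrict (φ '' S)) ((μHE[k] : Measure (Eucl d)).restrict S) := by
  have hm : Measurable (Function.invFun φ) := hφ.toHomeomorph.symm.measurable
  refine ⟨hm, Measure.AbsolutelyContinuous.mk fun s hs h0 => ?_⟩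
  rw [Measure.restrict_apply hs] at h0
  rw [Measure.map_apply hm hs, Measure.restrict_apply (hm hs), ← hφ.image_eq_preimage,
    ← image_inter hφ.bijective.1]
  exact hφ.measure_image_eq_zero h0

theorem map_normal (hφ : IsBilipDiffeo φ) (S : OrientedSet d) (x : Eucl d) :
    (S.map φ).normal (φ x) = conormal (fderiv ℝ φ x) (S.normal x) := by
  simp only [OrientedSet.map, hφ.invFun_apply]

theorem comp (hψ : IsBilipDiffeo ψ) (hφ : IsBilipDiffeo φ) : IsBilipDiffeo (ψ ∘ φ) where
  bijective := hψ.bijective.comp hφ.bijective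
  contDiff := hψ.contDiff.comp hφ.contDiff
  lipschitz := by
    obtain ⟨C, hC⟩ := hφ.lipschitz
    obtain ⟨C', hC'⟩ := hψ.lipschitz
    exact ⟨_, hC'.comp hC⟩
  antilipschitz := by
    obtain ⟨C, hC⟩ := hφ.antilipschitz
    obtain ⟨C', hC'⟩ := hψ.antilipschitz
    exact ⟨_, hC'.comp hC⟩
  isInvertible := fun x => by
    rw [fderiv_comp x (hψ.contDiff.differentiable one_ne_zero _)
      (hφ.contDiff.differentiable one_ne_zero _)]
    exact (hψ.isInvertible _).comp (hφ.isInvertible _)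

/-- Images of oriented sets compose, as an equality of sets and normals everywhere. -/
theorem map_map (hψ : IsBilipDiffeo ψ) (hφ : IsBilipDiffeo φ) (S : OrientedSet d) :
    (S.map φ).map ψ = S.map (ψ ∘ φ) := by
  have hc := hψ.comp hφ
  have h1 : ((S.map φ).map ψ).carrier = (S.map (ψ ∘ φ)).carrier := by
    simp only [OrientedSet.map, image_image, Function.comp]
  have h2 : ((S.map φ).map ψ).normal = (S.map (ψ ∘ φ)).normal := by
    funext y
    obtain ⟨x, rfl⟩ := hc.bijective.2 y
    rw [hc.map_normal, Function.comp_apply, hψ.map_normal, hφ.map_normal,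
      fderiv_comp x (hψ.contDiff.differentiable one_ne_zero _)
      (hφ.contDiff.differentiable one_ne_zero _)]
    obtain ⟨e, he⟩ := hφ.isInvertible x
    obtain ⟨f, hf⟩ := hψ.isInvertible (φ x)
    rw [← he, ← hf, conormal_trans]
    rfl
  cases h : (S.map φ).map ψ
  cases h' : S.map (ψ ∘ φ)
  simp_all

/-- Approximate normals are carried to approximate normals: up to an error that is small relative to
the distance, a cone around the approximate tangent plane is carried to a cone around its image. -/
theorem isUnitNormalAt_image (hφ : IsBilipDiffeo φ) {S : Set (Eucl d)} {x n : Eucl d}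
    (h : IsUnitNormalAt S x n) :
    IsUnitNormalAt (φ '' S) (φ x) (conormal (fderiv ℝ φ x) n) := by
  obtain ⟨e, he⟩ := hφ.isInvertible x
  obtain ⟨C, hC⟩ := hφ.lipschitz
  obtain ⟨c₀, hc₀⟩ := hφ.antilipschitz
  have hn0 : n ≠ 0 := by rintro rfl; simpa using h.1
  rw [← he]
  refine ⟨by rw [norm_conormal, h.1], fun ε hε => ?_⟩
  set m := conormal (e : Eucl d →L[ℝ] Eucl d) n with hm
  have hm1 : ‖m‖ = 1 := by rw [hm, norm_conormal, h.1]
  set c : ℝ := c₀ + 1 with hc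
  have hc0 : 0 < c := by positivity
  have hanti : ∀ z, ‖z - x‖ ≤ c * ‖φ z - φ x‖ := by
    intro z
    have := hc₀.le_mul_dist z x
    rw [dist_eq_norm, dist_eq_norm] at this
    rw [hc, add_mul]
    linarith [norm_nonneg (φ z - φ x)]
  set l := conormalScale e n with hl
  have hl0 : 0 < l := conormalScale_pos e hn0
  set ε' := ε / (2 * c * l) with hε'
  have hε'0 : 0 < ε' := by positivity
  have hderiv : HasFDerivAt φ (e : Eucl d →L[ℝ] Eucl d) x := by
    rw [he]; exact (hφ.contDiff.differentiable one_ne_zero x).hasFDerivAt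
  obtain ⟨δ, hδ, hball⟩ := Metric.eventually_nhds_iff_ball.1
    ((hasFDerivAt_iff_isLittleO.1 hderiv).def (show 0 < ε / (2 * c) by positivity))
  set G : ℝ → Set (Eucl d) := fun ρ =>
    S ∩ Metric.closedBall x ρ ∩ {z | ε' * ‖z - x‖ < |⟪z - x, n⟫|} with hG
  have hsub : ∀ r, c * r < δ →
      φ '' S ∩ Metric.closedBall (φ x) r ∩ {z | ε * ‖z - φ x‖ < |⟪z - φ x, m⟫|} ⊆
        φ '' (G (c * r)) := by
    rintro r hr _ ⟨⟨⟨z, hzS, rfl⟩, hzr⟩, hz⟩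
    have hz : ε * ‖φ z - φ x‖ < |⟪φ z - φ x, m⟫| := hz
    rw [Metric.mem_closedBall, dist_eq_norm] at hzr
    have h1 : ‖z - x‖ ≤ c * r := (hanti z).trans (by gcongr)
    have h2 : ‖φ z - φ x - e (z - x)‖ ≤ ε / (2 * c) * ‖z - x‖ :=
      hball z (by rw [Metric.mem_ball, dist_eq_norm]; linarith)
    refine ⟨z, ⟨⟨hzS, by rwa [Metric.mem_closedBall, dist_eq_norm]⟩, ?_⟩, rfl⟩
    show ε' * ‖z - x‖ < |⟪z - x, n⟫|
    have h3 : ⟪φ z - φ x, m⟫ = ⟪φ z - φ x - e (z - x), m⟫ + l * ⟪z - x, n⟫ := by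
      rw [← inner_map_conormal, inner_sub_left (φ z - φ x)]; ring
    have h4 : |⟪φ z - φ x - e (z - x), m⟫| ≤ ε / (2 * c) * ‖z - x‖ := by
      refine (abs_real_inner_le_norm _ _).trans ?_
      rwa [hm1, mul_one]
    have h5 : |⟪φ z - φ x, m⟫| ≤ ε / (2 * c) * ‖z - x‖ + l * |⟪z - x, n⟫| := by
      rw [h3]
      refine (abs_add_le _ _).trans ?_
      rw [abs_mul, abs_of_pos hl0]
      gcongr
    have h6 : ε / c * ‖z - x‖ ≤ ε * ‖φ z - φ x‖ := by
      calc ε / c * ‖z - x‖ ≤ ε / c * (c * ‖φ z - φ x‖) := by gcongr; exact hanti z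
        _ = _ := by field_simp
    have h7 : ε / c * ‖z - x‖ = ε / (2 * c) * ‖z - x‖ + l * (ε' * ‖z - x‖) := by
      rw [hε']; field_simp; ring
    have h8 : l * (ε' * ‖z - x‖) < l * |⟪z - x, n⟫| := by linarith
    exact lt_of_mul_lt_mul_left h8 hl0.le
  have hG0 : Tendsto (fun s : ℝ => μHE[d - 1] (G (c * s)) / ENNReal.ofReal ((c * s) ^ (d - 1)))
      (𝓝[>] 0) (𝓝 0) := by
    refine (h.2 ε' hε'0).comp (g := fun ρ : ℝ => μHE[d - 1] (G ρ) / _)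
      (f := fun s => c * s) ?_
    refine tendsto_nhdsWithin_iff.2 ⟨?_, ?_⟩
    · have : Tendsto (fun s : ℝ => c * s) (𝓝 0) (𝓝 (c * 0)) := tendsto_id.const_mul c
      rw [mul_zero] at this
      exact this.mono_left nhdsWithin_le_nhds
    · filter_upwards [self_mem_nhdsWithin] with s hs
      exact mul_pos hc0 hs
  have hlim : Tendsto (fun s : ℝ => ((C : ℝ≥0∞) ^ (d - 1) * ENNReal.ofReal (c ^ (d - 1))) *
      (μHE[d - 1] (G (c * s)) / ENNReal.ofReal ((c * s) ^ (d - 1)))) (𝓝[>] 0) (𝓝 0) := by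
    have := ENNReal.Tendsto.const_mul (a := (C : ℝ≥0∞) ^ (d - 1) * ENNReal.ofReal (c ^ (d - 1)))
      hG0 (Or.inr (by finiteness))
    rwa [mul_zero] at this
  refine tendsto_of_tendsto_of_tendsto_of_le_of_le' tendsto_const_nhds hlim
    (Eventually.of_forall fun _ => bot_le) ?_
  filter_upwards [Ioo_mem_nhdsGT (show 0 < δ / c by positivity)] with r hr
  have hrδ : c * r < δ := by
    have := hr.2; rw [lt_div_iff₀ hc0] at this; linarith
  have h1 := (measure_mono (hsub r hrδ)).trans
    (euclideanHausdorffMeasure_image_le_of_lipschitzOnWith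
      (hC.lipschitzOnWith (s := G (c * r))) (d - 1))
  have hr0 : 0 < r := hr.1
  have e1 : ENNReal.ofReal ((c * r) ^ (d - 1)) =
      ENNReal.ofReal (c ^ (d - 1)) * ENNReal.ofReal (r ^ (d - 1)) := by
    rw [mul_pow, ENNReal.ofReal_mul (by positivity)]
  have e2 : ENNReal.ofReal (c ^ (d - 1)) ≠ 0 := by
    rw [Ne, ENNReal.ofReal_eq_zero, not_le]; positivity
  have e4 := ENNReal.ofReal_ne_top (r := c ^ (d - 1))
  calc _ ≤ ((C : ℝ≥0∞) ^ (d - 1) * μHE[d - 1] (G (c * r))) / ENNReal.ofReal (r ^ (d - 1)) := by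
        gcongr
    _ = _ := by
        rw [e1]
        generalize ENNReal.ofReal (c ^ (d - 1)) = X at e2 e4 ⊢
        rw [div_eq_mul_inv, div_eq_mul_inv, ENNReal.mul_inv (Or.inl e2) (Or.inl e4)]
        calc _ = (C : ℝ≥0∞) ^ (d - 1) * μHE[d - 1] (G (c * r)) *
            (ENNReal.ofReal (r ^ (d - 1)))⁻¹ * 1 := by rw [mul_one]
          _ = _ := by rw [← ENNReal.mul_inv_cancel e2 e4]; ring

theorem isOrientedSurface_map (hφ : IsBilipDiffeo φ) {S : OrientedSet d}
    (hS : IsOrientedSurface S) : IsOrientedSurface (S.map φ) where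
  nullMeasurable := by
    obtain ⟨S₀, hS₀S, hS₀m, hS₀⟩ := hS.nullMeasurable.exists_measurable_subset_ae_eq
    show NullMeasurableSet (φ '' S.carrier) _
    have h1 : MeasurableSet (φ '' S₀) :=
      hφ.toHomeomorph.measurableEmbedding.measurableSet_image.2 hS₀m
    refine h1.nullMeasurableSet.congr ?_
    refine (LE.le.eventuallyLE (image_mono hS₀S)).antisymm (ae_le_set.2 ?_)
    rw [← image_sdiff hφ.bijective.1]
    exact hφ.measure_image_eq_zero (ae_le_set.1 hS₀.symm.le)
  locallyFinite := fun K hK => by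
    obtain ⟨C, hC⟩ := hφ.lipschitz
    have h1 : (S.map φ).carrier ∩ K ⊆ φ '' (S.carrier ∩ Function.invFun φ '' K) := by
      rintro _ ⟨⟨x, hx, rfl⟩, hK⟩
      exact ⟨x, ⟨hx, φ x, hK, hφ.invFun_apply x⟩, rfl⟩
    refine (measure_mono h1).trans_lt ((euclideanHausdorffMeasure_image_le_of_lipschitzOnWith
      hC.lipschitzOnWith (d - 1)).trans_lt (ENNReal.mul_lt_top (by finiteness) ?_))
    exact hS.locallyFinite _ (hK.image hφ.toHomeomorph.symm.continuous)
  rectifiable := by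
    obtain ⟨C, hC⟩ := hφ.lipschitz
    obtain ⟨f, hf, hnull⟩ := hS.rectifiable
    refine ⟨fun i => φ ∘ f i, fun i => ⟨_, hC.comp (hf i).choose_spec⟩, ?_⟩
    refine measure_mono_null ?_ (hφ.measure_image_eq_zero hnull)
    rintro _ ⟨⟨x, hx, rfl⟩, h⟩
    refine ⟨x, ⟨hx, fun h' => h ?_⟩, rfl⟩
    obtain ⟨i, p, rfl⟩ := mem_iUnion.1 h'
    exact mem_iUnion.2 ⟨i, p, rfl⟩
  measurable_normal := by
    have h1 : AEMeasurable (fun x => conormal (fderiv ℝ φ x) (S.normal x))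
        (μHE[d - 1].restrict S.carrier) := by
      have h2 : Continuous fun x =>
          (ContinuousLinearMap.adjoint (fderiv ℝ φ x)).inverse := by
        refine continuous_iff_continuousAt.2 fun x => ?_
        obtain ⟨e, he⟩ := hφ.isInvertible x
        have h3 : ContinuousAt ContinuousLinearMap.inverse
            (ContinuousLinearMap.adjoint (fderiv ℝ φ x)) := by
          refine (ContinuousLinearMap.IsInvertible.contDiffAt_map_inverse (𝕜 := ℝ) (n := 0)
            ?_).continuousAt
          rw [← he]
          exact ContinuousLinearMap.IsInvertible.of_inverse
            (g := ContinuousLinearMap.adjoint (e.symm : Eucl d →L[ℝ] Eucl d))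
            (by ext1 n; exact adjoint_adjoint_symm e n)
            (by ext1 n; exact adjoint_adjoint_symm e.symm n)
        exact ContinuousAt.comp (f := fun x => ContinuousLinearMap.adjoint (fderiv ℝ φ x)) h3
          ((ContinuousLinearMap.adjoint.continuous.comp
            (hφ.contDiff.continuous_fderiv one_ne_zero)).continuousAt)
      have h4 : AEMeasurable (fun x => (ContinuousLinearMap.adjoint (fderiv ℝ φ x)).inverse
          (S.normal x)) (μHE[d - 1].restrict S.carrier) := by
        have h5 : Continuous fun p : (Eucl d →L[ℝ] Eucl d) × Eucl d => p.1 p.2 := by fun_prop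
        exact h5.measurable.comp_aemeasurable
          (h2.measurable.aemeasurable.prodMk hS.measurable_normal)
      unfold conormal
      exact (hS.measurable_normal.norm.div h4.norm).smul h4
    exact h1.comp_quasiMeasurePreserving (hφ.quasiMeasurePreserving_invFun _ _)
  isUnitNormal := by
    have h1 := (hφ.quasiMeasurePreserving_invFun (d - 1) S.carrier).ae hS.isUnitNormal
    filter_upwards [h1] with y hy
    have h2 := hφ.isUnitNormalAt_image hy
    rwa [hφ.apply_invFun] at h2

end IsBilipDiffeo

/-! ### The area formula for affine maps; energy and flux -/

section Affine

variable {d : ℕ} (e : Eucl d ≃L[ℝ] Eucl d) (b : Eucl d)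

theorem affMap_equiv_apply (x : Eucl d) : affMap (e : Eucl d →L[ℝ] Eucl d) b x = e x + b := rfl

theorem affMap_equiv_sub (x y : Eucl d) :
    affMap (e : Eucl d →L[ℝ] Eucl d) b x - affMap (e : Eucl d →L[ℝ] Eucl d) b y = e (x - y) := by
  simp [affMap_equiv_apply]

theorem hasFDerivAt_affMap (x : Eucl d) :
    HasFDerivAt (affMap (e : Eucl d →L[ℝ] Eucl d) b) (e : Eucl d →L[ℝ] Eucl d) x :=
  (e : Eucl d →L[ℝ] Eucl d).hasFDerivAt.add_const b

theorem fderiv_affMap (x : Eucl d) :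
    fderiv ℝ (affMap (e : Eucl d →L[ℝ] Eucl d) b) x = (e : Eucl d →L[ℝ] Eucl d) :=
  (hasFDerivAt_affMap e b x).fderiv

theorem affMap_symm_affMap (x : Eucl d) :
    affMap (e.symm : Eucl d →L[ℝ] Eucl d) (-(e.symm b))
      (affMap (e : Eucl d →L[ℝ] Eucl d) b x) = x := by
  simp [affMap]

theorem affMap_affMap_symm (x : Eucl d) :
    affMap (e : Eucl d →L[ℝ] Eucl d) b
      (affMap (e.symm : Eucl d →L[ℝ] Eucl d) (-(e.symm b)) x) = x := by
  simp [affMap]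

theorem isBilipDiffeo_affMap : IsBilipDiffeo (affMap (e : Eucl d →L[ℝ] Eucl d) b) where
  bijective := ⟨Function.LeftInverse.injective (affMap_symm_affMap e b),
    Function.RightInverse.surjective (affMap_affMap_symm e b)⟩
  contDiff := (e : Eucl d →L[ℝ] Eucl d).contDiff.add contDiff_const
  lipschitz := ⟨_, LipschitzWith.of_dist_le_mul (K := ‖(e : Eucl d →L[ℝ] Eucl d)‖₊) fun x y => by
    rw [dist_eq_norm, dist_eq_norm, affMap_equiv_sub]
    exact (e : Eucl d →L[ℝ] Eucl d).le_opNorm _⟩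
  antilipschitz := ⟨_, AntilipschitzWith.of_le_mul_dist
    (K := ‖(e.symm : Eucl d →L[ℝ] Eucl d)‖₊) fun x y => by
      rw [dist_eq_norm, dist_eq_norm, affMap_equiv_sub]
      simpa using (e.symm : Eucl d →L[ℝ] Eucl d).le_opNorm (e (x - y))⟩
  isInvertible := fun x => ⟨e, (fderiv_affMap e b x).symm⟩

theorem normal_map_affMap (S : OrientedSet d) (x : Eucl d) :
    (S.map (affMap (e : Eucl d →L[ℝ] Eucl d) b)).normal (affMap (e : Eucl d →L[ℝ] Eucl d) b x) =
      conormal (e : Eucl d →L[ℝ] Eucl d) (S.normal x) := by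
  rw [(isBilipDiffeo_affMap e b).map_normal, fderiv_affMap]

theorem OrientedSet.map_id (S : OrientedSet d) : S.map id = S := by
  have h1 : (S.map id).normal = S.normal := by
    funext x
    have h2 : Function.invFun (id : Eucl d → Eucl d) x = x :=
      Function.leftInverse_invFun Function.injective_id x
    simp only [OrientedSet.map, h2, fderiv_id]
    exact conormal_refl _
  have h2 : (S.map id).carrier = S.carrier := by simp [OrientedSet.map]
  cases h : S.map id
  cases S
  simp_all

/-- An oriented set is the image of its image under the inverse affine map, exactly and not only up
to null sets. -/
theorem map_affMap_map_affMap_symm (S : OrientedSet d) :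
    (S.map (affMap (e.symm : Eucl d →L[ℝ] Eucl d) (-(e.symm b)))).map
      (affMap (e : Eucl d →L[ℝ] Eucl d) b) = S := by
  rw [(isBilipDiffeo_affMap e b).map_map (isBilipDiffeo_affMap e.symm _)]
  have : affMap (e : Eucl d →L[ℝ] Eucl d) b ∘
      affMap (e.symm : Eucl d →L[ℝ] Eucl d) (-(e.symm b)) = id :=
    funext (affMap_affMap_symm e b)
  rw [this, S.map_id]

theorem map_affMap_symm_map_affMap (S : OrientedSet d) :
    (S.map (affMap (e : Eucl d →L[ℝ] Eucl d) b)).map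
      (affMap (e.symm : Eucl d →L[ℝ] Eucl d) (-(e.symm b))) = S := by
  rw [(isBilipDiffeo_affMap e.symm _).map_map (isBilipDiffeo_affMap e b)]
  have : affMap (e.symm : Eucl d →L[ℝ] Eucl d) (-(e.symm b)) ∘
      affMap (e : Eucl d →L[ℝ] Eucl d) b = id :=
    funext (affMap_symm_affMap e b)
  rw [this, S.map_id]

theorem transf_symm_transf (Φ : Eucl d → ℝ) :
    transf (e.symm : Eucl d →L[ℝ] Eucl d) (transf (e : Eucl d →L[ℝ] Eucl d) Φ) = Φ := by
  funext q
  simp only [transf, adjoint_adjoint_symm]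

theorem isAsymNorm_transf {Φ : Eucl d → ℝ} (hΦ : IsAsymNorm Φ) :
    IsAsymNorm (transf (e : Eucl d →L[ℝ] Eucl d) Φ) where
  nonneg n := hΦ.nonneg _
  eq_zero_iff n := by
    rw [transf, hΦ.eq_zero_iff]
    refine ⟨fun h => ?_, fun h => by rw [h, map_zero]⟩
    by_contra hn
    exact adjoint_symm_ne_zero e.symm hn h
  pos_homog r n hr := by rw [transf, map_smul, hΦ.pos_homog _ _ hr]; rfl
  subadd n p := by rw [transf, map_add]; exact hΦ.subadd _ _

/-- The value of `Φ_A` at the new normal: the adjoint undoes the inverse adjoint. The factor cancels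
against the area factor in the energy and appears in the normal velocity. -/
theorem transf_conormal {Φ : Eucl d → ℝ} (hΦ : IsAsymNorm Φ) (n : Eucl d) :
    transf (e : Eucl d →L[ℝ] Eucl d) Φ (conormal (e : Eucl d →L[ℝ] Eucl d) n) =
      conormalScale e n * Φ n := by
  rw [transf, adjoint_conormal, hΦ.pos_homog _ _ (conormalScale_nonneg e n)]

/-- The area factors of `e` and of `e⁻¹` at corresponding normals are inverse to each other. -/
theorem areaFactor_symm_conormal {n : Eucl d} (hn : ‖n‖ = 1) :
    areaFactor e.symm (conormal (e : Eucl d →L[ℝ] Eucl d) n) * areaFactor e n = 1 := by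
  have hn0 : n ≠ 0 := by rintro rfl; simp at hn
  have h1 := norm_pos_iff.2 (adjoint_symm_ne_zero e hn0)
  have hdet : (e : Eucl d →L[ℝ] Eucl d).det * (e.symm : Eucl d →L[ℝ] Eucl d).det = 1 := by
    rw [ContinuousLinearMap.det, ContinuousLinearMap.det, ← LinearMap.det_comp]
    convert LinearMap.det_id (M := Eucl d)
    ext1 x
    simp
  have hdet' : |(e : Eucl d →L[ℝ] Eucl d).det| * |(e.symm : Eucl d →L[ℝ] Eucl d).det| = 1 := by
    rw [← abs_mul, hdet, abs_one]
  rw [areaFactor, areaFactor]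
  change |(e.symm : Eucl d →L[ℝ] Eucl d).det| * ‖ContinuousLinearMap.adjoint
    (e : Eucl d →L[ℝ] Eucl d) _‖ * _ = 1
  rw [adjoint_conormal, norm_smul, hn, mul_one, Real.norm_eq_abs,
    abs_of_nonneg (conormalScale_nonneg e n), conormalScale, hn]
  calc _ = (|(e : Eucl d →L[ℝ] Eucl d).det| * |(e.symm : Eucl d →L[ℝ] Eucl d).det|) *
      (1 / ‖ContinuousLinearMap.adjoint (e.symm : Eucl d →L[ℝ] Eucl d) n‖ *
        ‖ContinuousLinearMap.adjoint (e.symm : Eucl d →L[ℝ] Eucl d) n‖) := by ring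
    _ = 1 := by rw [hdet', one_div_mul_cancel h1.ne', one_mul]

theorem aemeasurable_areaFactor {S : OrientedSet d} (hS : IsOrientedSurface S) :
    AEMeasurable (fun x => ENNReal.ofReal (areaFactor e (S.normal x)))
      (μHE[d - 1].restrict S.carrier) :=
  ((continuous_areaFactor e).measurable.comp_aemeasurable hS.measurable_normal).ennreal_ofReal

theorem map_restrict_map_symm {k : ℕ} (S : Set (Eucl d)) :
    (((μHE[k] : Measure (Eucl d)).map e.symm).restrict S).map e = μHE[k].restrict (e '' S) := by
  have h1 : MeasurableEmbedding (e.symm : Eucl d → Eucl d) :=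
    e.symm.toHomeomorph.measurableEmbedding
  have h2 : MeasurableEmbedding (e : Eucl d → Eucl d) := e.toHomeomorph.measurableEmbedding
  rw [h1.restrict_map, Measure.map_map h2.measurable h1.measurable, e.image_eq_preimage_symm]
  have : (e : Eucl d → Eucl d) ∘ e.symm = id := funext e.apply_symm_apply
  rw [this, Measure.map_id]

/-- Area formula for linear isomorphisms: the upper bound for `e`, together with the upper bound for
`e⁻¹` on the image surface. -/
theorem restrict_map_symm_eq {S : OrientedSet d} (hS : IsOrientedSurface S) :
    ((μHE[d - 1] : Measure (Eucl d)).map e.symm).restrict S.carrier =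
      ((μHE[d - 1] : Measure (Eucl d)).restrict S.carrier).withDensity
        fun x => ENNReal.ofReal (areaFactor e (S.normal x)) := by
  set μ := (μHE[d - 1] : Measure (Eucl d)) with hμ
  have hup := restrict_map_symm_le e hS
  have hemb : MeasurableEmbedding (e : Eucl d → Eucl d) := e.toHomeomorph.measurableEmbedding
  set ν := (μ.map e.symm).restrict S.carrier with hν
  set J : Eucl d → ℝ≥0∞ := fun x => ENNReal.ofReal (areaFactor e (S.normal x)) with hJ
  set J₁ : Eucl d → ℝ≥0∞ := fun x => ENNReal.ofReal (areaFactor e.symm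
    (conormal (e : Eucl d →L[ℝ] Eucl d) (S.normal x))) with hJ₁
  refine le_antisymm hup ?_
  have hac : ν ≪ μ.restrict S.carrier :=
    (Measure.absolutelyContinuous_of_le hup).trans (withDensity_absolutelyContinuous _ _)
  have hJm : AEMeasurable J (μ.restrict S.carrier) := aemeasurable_areaFactor e hS
  have hJ₁m : AEMeasurable J₁ (μ.restrict S.carrier) :=
    (((continuous_areaFactor e.symm).comp (continuous_conormal e)).measurable.comp_aemeasurable
      hS.measurable_normal).ennreal_ofReal
  have hmap0 : affMap (e : Eucl d →L[ℝ] Eucl d) 0 = e := by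
    funext x; simp [affMap]
  have hS₁ := (isBilipDiffeo_affMap e 0).isOrientedSurface_map hS
  have hnorm := normal_map_affMap e 0 S
  rw [hmap0] at hS₁ hnorm
  -- the upper bound for `e⁻¹` on `e(S)`, transported back to `S`
  have hlow : μ.restrict S.carrier ≤ ν.withDensity J₁ := by
    have hup₁ := restrict_map_symm_le e.symm hS₁
    refine Measure.le_iff.2 fun G hG => ?_
    have h1 := hup₁ (e '' G)
    have heG : MeasurableSet (e '' G) := hemb.measurableSet_image.2 hG
    have h2 : μ.restrict S.carrier G = ((μ.map e.symm.symm).restrict (S.map e).carrier) (e '' G) := by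
      rw [Measure.restrict_apply heG, map_symm_apply, Measure.restrict_apply hG]
      congr 1
      show _ = e.symm '' (e '' G ∩ e '' S.carrier)
      rw [← image_inter e.injective, image_image]
      simp
    rw [h2]
    refine h1.trans (le_of_eq ?_)
    rw [withDensity_apply _ heG, withDensity_apply _ hG]
    change ∫⁻ a in e '' G, _ ∂(μ.restrict (e '' S.carrier)) = _
    rw [hμ, ← map_restrict_map_symm, hemb.restrict_map, hemb.lintegral_map,
      preimage_image_eq _ e.injective]
    simp only [hnorm, hJ₁]
    rfl
  refine Measure.le_iff.2 fun G hG => ?_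
  rw [withDensity_apply _ hG]
  calc ∫⁻ x in G, J x ∂(μ.restrict S.carrier)
      ≤ ∫⁻ x in G, J x ∂(ν.withDensity J₁) :=
        lintegral_mono' (Measure.restrict_mono le_rfl hlow) le_rfl
    _ = ∫⁻ x in G, (J₁ * J) x ∂ν := by
        rw [restrict_withDensity hG, lintegral_withDensity_eq_lintegral_mul₀]
        · exact (hJ₁m.mono_ac hac).restrict
        · exact (hJm.mono_ac hac).restrict
    _ = ∫⁻ x in G, 1 ∂ν := by
        refine lintegral_congr_ae (ae_restrict_of_ae ?_)
        filter_upwards [hac.ae_le hS.isUnitNormal] with x hx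
        rw [Pi.mul_apply, hJ₁, hJ, ← ENNReal.ofReal_mul (areaFactor_nonneg _ _),
          areaFactor_symm_conormal e hx.1, ENNReal.ofReal_one]
    _ = ν G := by simp

/-- Area formula for affine isomorphisms. -/
theorem map_affMap_withDensity {S : OrientedSet d} (hS : IsOrientedSurface S) :
    (((μHE[d - 1] : Measure (Eucl d)).restrict S.carrier).withDensity
      fun x => ENNReal.ofReal (areaFactor e (S.normal x))).map
        (affMap (e : Eucl d →L[ℝ] Eucl d) b) =
      μHE[d - 1].restrict (affMap (e : Eucl d →L[ℝ] Eucl d) b '' S.carrier) := by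
  rw [← restrict_map_symm_eq e hS]
  have hb : MeasurableEmbedding fun x : Eucl d => x + b :=
    (Homeomorph.addRight b).measurableEmbedding
  have h1 : affMap (e : Eucl d →L[ℝ] Eucl d) b = (fun x => x + b) ∘ e := rfl
  rw [h1, ← Measure.map_map hb.measurable e.continuous.measurable, map_restrict_map_symm,
    image_comp]
  refine Measure.ext fun G hG => ?_
  rw [hb.map_apply, Measure.restrict_apply (hb.measurable hG), Measure.restrict_apply hG,
    ← euclideanHausdorffMeasure_image_add_const _ _ b, inter_comm, image_inter_preimage, inter_comm]

theorem lintegral_image_affMap {S : OrientedSet d} (hS : IsOrientedSurface S)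
    (F : Eucl d → ℝ≥0∞) :
    ∫⁻ y in affMap (e : Eucl d →L[ℝ] Eucl d) b '' S.carrier, F y ∂μHE[d - 1] =
      ∫⁻ x in S.carrier, ENNReal.ofReal (areaFactor e (S.normal x)) *
        F (affMap (e : Eucl d →L[ℝ] Eucl d) b x) ∂μHE[d - 1] := by
  have hemb := (isBilipDiffeo_affMap e b).toHomeomorph.measurableEmbedding
  rw [← map_affMap_withDensity e b hS]
  refine (hemb.lintegral_map F).trans ?_
  rw [lintegral_withDensity_eq_lintegral_mul_non_measurable₀ _
    (aemeasurable_areaFactor e hS)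
    (Eventually.of_forall fun _ => ENNReal.ofReal_lt_top)]
  rfl

theorem integral_image_affMap {S : OrientedSet d} (hS : IsOrientedSurface S) (F : Eucl d → ℝ) :
    ∫ y in affMap (e : Eucl d →L[ℝ] Eucl d) b '' S.carrier, F y ∂μHE[d - 1] =
      ∫ x in S.carrier, areaFactor e (S.normal x) *
        F (affMap (e : Eucl d →L[ℝ] Eucl d) b x) ∂μHE[d - 1] := by
  have hemb := (isBilipDiffeo_affMap e b).toHomeomorph.measurableEmbedding
  rw [← map_affMap_withDensity e b hS]
  refine (hemb.integral_map F).trans ?_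
  rw [integral_withDensity_eq_integral_toReal_smul₀
    (aemeasurable_areaFactor e hS)
    (Eventually.of_forall fun _ => ENNReal.ofReal_lt_top)]
  refine integral_congr_ae (Eventually.of_forall fun x => ?_)
  simp only [ENNReal.toReal_ofReal (areaFactor_nonneg e _), smul_eq_mul]
  rfl

theorem energy_map_affMap {Φ : Eucl d → ℝ} (hΦ : IsAsymNorm Φ) {S : OrientedSet d}
    (hS : IsOrientedSurface S) :
    energy (transf (e : Eucl d →L[ℝ] Eucl d) Φ) (S.map (affMap (e : Eucl d →L[ℝ] Eucl d) b)) =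
      ENNReal.ofReal |(e : Eucl d →L[ℝ] Eucl d).det| * energy Φ S := by
  rw [energy, energy]
  refine (lintegral_image_affMap e b hS _).trans ?_
  rw [← lintegral_const_mul' _ _ ENNReal.ofReal_ne_top]
  refine lintegral_congr_ae ?_
  filter_upwards [hS.isUnitNormal] with x hx
  rw [normal_map_affMap, transf_conormal e hΦ, ← ENNReal.ofReal_mul (areaFactor_nonneg _ _),
    ← mul_assoc, areaFactor_mul_conormalScale e hx.1, ENNReal.ofReal_mul (abs_nonneg _)]

/-- The weighted flux of a vector field scales like volume. -/
theorem integral_inner_map_affMap {S : OrientedSet d} (hS : IsOrientedSurface S)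
    {g gA : Eucl d → Eucl d} {k kA : Eucl d → ℝ}
    (hg : ∀ x, gA (affMap (e : Eucl d →L[ℝ] Eucl d) b x) = e (g x))
    (hk : ∀ x, kA (affMap (e : Eucl d →L[ℝ] Eucl d) b x) = k x) :
    ∫ y in (S.map (affMap (e : Eucl d →L[ℝ] Eucl d) b)).carrier,
      ⟪gA y, (S.map (affMap (e : Eucl d →L[ℝ] Eucl d) b)).normal y⟫ * kA y ∂μHE[d - 1] =
      |(e : Eucl d →L[ℝ] Eucl d).det| *
        ∫ x in S.carrier, ⟪g x, S.normal x⟫ * k x ∂μHE[d - 1] := by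
  refine (integral_image_affMap e b hS _).trans ?_
  rw [← integral_const_mul]
  refine integral_congr_ae ?_
  filter_upwards [hS.isUnitNormal] with x hx
  rw [normal_map_affMap, hg, hk, inner_map_conormal,
    ← areaFactor_mul_conormalScale e hx.1]
  ring

end Affine

/-! ### First variation of the energy -/

theorem IsOrientedSurface.part {d : ℕ} {S : OrientedSet d} (hS : IsOrientedSurface S)
    {K : Set (Eucl d)} (hK : IsClosed K) : IsOrientedSurface (S.part K) where
  nullMeasurable := hS.nullMeasurable.inter hK.measurableSet.nullMeasurableSet
  locallyFinite := fun K' hK' => (measure_mono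
    (inter_subset_inter_left K' inter_subset_left)).trans_lt (hS.locallyFinite K' hK')
  rectifiable := by
    obtain ⟨f, hf, h⟩ := hS.rectifiable
    exact ⟨f, hf, measure_mono_null (sdiff_subset_sdiff_left inter_subset_left) h⟩
  measurable_normal := hS.measurable_normal.mono_measure
    (Measure.restrict_mono inter_subset_left le_rfl)
  isUnitNormal := by
    have h1 : ∀ᵐ x ∂(μHE[d - 1].restrict (S.part K).carrier),
        IsUnitNormalAt S.carrier x (S.normal x) :=
      ae_mono (Measure.restrict_mono inter_subset_left le_rfl) hS.isUnitNormal
    filter_upwards [h1] with x hx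
    refine ⟨hx.1, fun ε hε => ?_⟩
    refine tendsto_of_tendsto_of_tendsto_of_le_of_le tendsto_const_nhds (hx.2 ε hε)
      (fun _ => bot_le) fun r => ?_
    refine ENNReal.div_le_div_right (measure_mono ?_) _
    exact inter_subset_inter_left _ (inter_subset_inter_left _ inter_subset_left)

/-- Perturbations of the identity with Lipschitz constant at most `1 / 2` are diffeomorphisms. -/
theorem isBilipDiffeo_add_smul {d : ℕ} {g : Eucl d → Eucl d} {C : ℝ≥0} (hg : ContDiff ℝ 1 g)
    (hC : LipschitzWith C g) {h : ℝ} (hh : |h| * C ≤ 1 / 2) :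
    IsBilipDiffeo fun x => x + h • g x := by
  have hgd : Differentiable ℝ g := hg.differentiable one_ne_zero
  have hlip : ∀ x y, ‖h • g x - h • g y‖ ≤ 1 / 2 * ‖x - y‖ := by
    intro x y
    rw [← smul_sub, norm_smul, Real.norm_eq_abs]
    have h1 := hC.dist_le_mul x y
    rw [dist_eq_norm, dist_eq_norm] at h1
    calc |h| * ‖g x - g y‖ ≤ |h| * (C * ‖x - y‖) := by gcongr
      _ = (|h| * C) * ‖x - y‖ := by ring
      _ ≤ _ := by gcongr
  have happ : ApproximatesLinearOn (fun x => x + h • g x)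
      (ContinuousLinearEquiv.refl ℝ (Eucl d) : Eucl d →L[ℝ] Eucl d) univ (1 / 2) := by
    intro x _ y _
    have h1 : x + h • g x - (y + h • g y) -
        (ContinuousLinearEquiv.refl ℝ (Eucl d) : Eucl d →L[ℝ] Eucl d) (x - y) =
        h • g x - h • g y := by
      simp only [ContinuousLinearEquiv.coe_refl, ContinuousLinearMap.id_apply]
      abel
    rw [h1]
    simpa using hlip x y
  have hanti : AntilipschitzWith 2 fun x => x + h • g x := by
    refine AntilipschitzWith.of_le_mul_dist fun x y => ?_
    rw [dist_eq_norm, dist_eq_norm]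
    have h1 := norm_sub_le (x + h • g x - (y + h • g y)) (h • g x - h • g y)
    have h2 : x + h • g x - (y + h • g y) - (h • g x - h • g y) = x - y := by abel
    rw [h2] at h1
    have h3 : ((2 : ℝ≥0) : ℝ) = 2 := rfl
    rw [h3]
    linarith [hlip x y]
  refine ⟨⟨hanti.injective, ?_⟩, contDiff_id.add (hg.const_smul h), ?_, ⟨_, hanti⟩, ?_⟩
  · refine happ.surjective ?_
    rcases subsingleton_or_nontrivial (Eucl d) with hs | hs
    · exact Or.inl hs
    · right
      have : ‖((ContinuousLinearEquiv.refl ℝ (Eucl d)).symm : Eucl d →L[ℝ] Eucl d)‖₊ = 1 := by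
        ext
        exact ContinuousLinearMap.norm_id
      rw [this, inv_one]
      exact NNReal.half_lt_self one_ne_zero
  · refine ⟨2, LipschitzWith.of_dist_le_mul fun x y => ?_⟩
    rw [dist_eq_norm, dist_eq_norm]
    have h1 := norm_add_le (x - y) (h • g x - h • g y)
    have h2 : x + h • g x - (y + h • g y) = (x - y) + (h • g x - h • g y) := by abel
    have h3 : ((2 : ℝ≥0) : ℝ) = 2 := rfl
    rw [h2, h3]
    linarith [hlip x y, norm_nonneg (x - y)]
  · intro x
    have h1 : HasFDerivAt (fun x => x + h • g x)
        (ContinuousLinearMap.id ℝ (Eucl d) + h • fderiv ℝ g x) x :=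
      (hasFDerivAt_id x).add ((hgd x).hasFDerivAt.const_smul h)
    rw [h1.fderiv]
    have hinj : Function.Injective
        ((ContinuousLinearMap.id ℝ (Eucl d) + h • fderiv ℝ g x : Eucl d →L[ℝ] Eucl d) :
          Eucl d →ₗ[ℝ] Eucl d) := by
      refine (injective_iff_map_eq_zero _).2 fun v hv => ?_
      have hv : v + h • fderiv ℝ g x v = 0 := hv
      have h2 : ‖v‖ = |h| * ‖fderiv ℝ g x v‖ := by
        rw [eq_neg_of_add_eq_zero_left hv, norm_neg, norm_smul, Real.norm_eq_abs]
        congr 2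
        rw [← eq_neg_of_add_eq_zero_left hv]
      have h3 : ‖fderiv ℝ g x v‖ ≤ C * ‖v‖ :=
        ((fderiv ℝ g x).le_opNorm v).trans
          (by gcongr; exact norm_fderiv_le_of_lipschitz ℝ hC)
      have h4 : ‖v‖ ≤ 1 / 2 * ‖v‖ := by
        calc ‖v‖ = |h| * ‖fderiv ℝ g x v‖ := h2
          _ ≤ |h| * (C * ‖v‖) := by gcongr
          _ = (|h| * C) * ‖v‖ := by ring
          _ ≤ _ := by gcongr
      exact norm_le_zero_iff.1 (by linarith)
    refine ⟨(LinearEquiv.ofInjectiveEndo _ hinj).toContinuousLinearEquiv, ?_⟩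
    ext1 v
    rfl

theorem IsTestField.exists_isBilipDiffeo {d : ℕ} {V : Set (Eucl d)} {g : Eucl d → Eucl d}
    (hg : IsTestField V g) : ∀ᶠ h in 𝓝 (0 : ℝ), IsBilipDiffeo fun x => x + h • g x := by
  have h1 : ContDiff ℝ 1 g := hg.1.of_le (by exact_mod_cast le_top)
  obtain ⟨C, hC⟩ := h1.lipschitzWith_of_hasCompactSupport hg.2.1 one_ne_zero
  have h2 : Tendsto (fun h : ℝ => |h| * C) (𝓝 0) (𝓝 0) := by
    have : Continuous fun h : ℝ => |h| * C := by fun_prop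
    simpa using this.tendsto 0
  filter_upwards [h2.eventually (ge_mem_nhds (show (0 : ℝ) < 1 / 2 by norm_num))] with h hh
  exact isBilipDiffeo_add_smul h1 hC hh

section Deformation

variable {d : ℕ} (e : Eucl d ≃L[ℝ] Eucl d) (b : Eucl d) {g gA : Eucl d → Eucl d}

theorem tsupport_of_affMap (hg : ∀ x, gA (affMap (e : Eucl d →L[ℝ] Eucl d) b x) = e (g x)) :
    tsupport gA = affMap (e : Eucl d →L[ℝ] Eucl d) b '' tsupport g := by
  have h := (isBilipDiffeo_affMap e b).toHomeomorph.image_closure (Function.support g)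
  change affMap (e : Eucl d →L[ℝ] Eucl d) b '' closure _ =
    closure (affMap (e : Eucl d →L[ℝ] Eucl d) b '' _) at h
  rw [tsupport, tsupport, h]
  congr 1
  ext y
  obtain ⟨x, rfl⟩ := (isBilipDiffeo_affMap e b).bijective.2 y
  rw [(isBilipDiffeo_affMap e b).bijective.1.mem_set_image, Function.mem_support,
    Function.mem_support, hg]
  simp

theorem IsTestField.of_affMap (hg : ∀ x, gA (affMap (e : Eucl d →L[ℝ] Eucl d) b x) = e (g x))
    {V : Set (Eucl d)} (h : IsTestField V g) :
    IsTestField (affMap (e : Eucl d →L[ℝ] Eucl d) b '' V) gA := by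
  have h1 : gA = fun y => e (g (affMap (e.symm : Eucl d →L[ℝ] Eucl d) (-(e.symm b)) y)) := by
    funext y
    rw [← hg, affMap_affMap_symm]
  refine ⟨?_, ?_, ?_⟩
  · rw [h1]
    exact e.contDiff.comp (h.1.comp ((e.symm : Eucl d →L[ℝ] Eucl d).contDiff.add contDiff_const))
  · rw [HasCompactSupport, tsupport_of_affMap e b hg]
    exact h.2.1.isCompact.image (isBilipDiffeo_affMap e b).contDiff.continuous
  · rw [tsupport_of_affMap e b hg]
    exact image_mono h.2.2

theorem IsTestField.of_affMap_symm
    (hg : ∀ x, gA (affMap (e : Eucl d →L[ℝ] Eucl d) b x) = e (g x))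
    {V : Set (Eucl d)} (h : IsTestField (affMap (e : Eucl d →L[ℝ] Eucl d) b '' V) gA) :
    IsTestField V g := by
  have h1 := IsTestField.of_affMap e.symm (-(e.symm b)) (g := gA) (gA := g) (fun y => by
    obtain ⟨x, rfl⟩ := (isBilipDiffeo_affMap e b).bijective.2 y
    rw [affMap_symm_affMap, hg, e.symm_apply_apply]) h
  rw [image_image] at h1
  simpa only [affMap_symm_affMap, image_id'] using h1

/-- For small `h`, the affine map carries the deformation of `S` by `h g` to the deformation of the
image surface by `h g_A`. -/
theorem eventually_deformedEnergy_transf {Φ : Eucl d → ℝ} (hΦ : IsAsymNorm Φ) {S : OrientedSet d}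
    (hS : IsOrientedSurface S)
    (hg : ∀ x, gA (affMap (e : Eucl d →L[ℝ] Eucl d) b x) = e (g x)) {V : Set (Eucl d)}
    (ht : IsTestField V g) :
    ∀ᶠ h in 𝓝 (0 : ℝ), deformedEnergy (transf (e : Eucl d →L[ℝ] Eucl d) Φ)
      (S.map (affMap (e : Eucl d →L[ℝ] Eucl d) b)) gA h =
        |(e : Eucl d →L[ℝ] Eucl d).det| * deformedEnergy Φ S g h := by
  filter_upwards [ht.exists_isBilipDiffeo] with h hφ
  have hA := isBilipDiffeo_affMap e b
  set A := affMap (e : Eucl d →L[ℝ] Eucl d) b with hAdef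
  -- the deformations are conjugate under the affine map
  have hcomm : (fun y => y + h • gA y) ∘ A = A ∘ fun x => x + h • g x := by
    funext x
    simp only [Function.comp, hg]
    simp only [hAdef, affMap_equiv_apply, map_add, map_smul]
    abel
  have hφA : IsBilipDiffeo fun y => y + h • gA y := by
    have h1 := (hA.comp hφ).comp (isBilipDiffeo_affMap e.symm (-(e.symm b)))
    rw [← hcomm] at h1
    convert h1 using 1
    funext y
    simp only [Function.comp, hAdef, affMap_affMap_symm]
  have hpart : (S.map A).part (tsupport gA) = (S.part (tsupport g)).map A := by
    simp only [OrientedSet.part, OrientedSet.map, tsupport_of_affMap e b hg,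
      image_inter hA.bijective.1]
    rfl
  rw [deformedEnergy, deformedEnergy, hpart, hφA.map_map hA, hcomm, ← hA.map_map hφ,
    energy_map_affMap e b hΦ
      (hφ.isOrientedSurface_map (hS.part (isClosed_tsupport g))),
    ENNReal.toReal_mul, ENNReal.toReal_ofReal (abs_nonneg _)]

theorem det_equiv_ne_zero : (e : Eucl d →L[ℝ] Eucl d).det ≠ 0 :=
  (LinearEquiv.isUnit_det' e.toLinearEquiv).ne_zero

/-- First variations of the energy, two-sided or one-sided, correspond with the factor `|det e|`. -/
theorem hasDerivWithinAt_deformedEnergy_transf_iff {Φ : Eucl d → ℝ} (hΦ : IsAsymNorm Φ)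
    {S : OrientedSet d} (hS : IsOrientedSurface S)
    (hg : ∀ x, gA (affMap (e : Eucl d →L[ℝ] Eucl d) b x) = e (g x)) {V : Set (Eucl d)}
    (ht : IsTestField V g) {s : Set ℝ} {a : ℝ} :
    HasDerivWithinAt (deformedEnergy (transf (e : Eucl d →L[ℝ] Eucl d) Φ)
      (S.map (affMap (e : Eucl d →L[ℝ] Eucl d) b)) gA)
        (|(e : Eucl d →L[ℝ] Eucl d).det| * a) s 0 ↔
      HasDerivWithinAt (deformedEnergy Φ S g) a s 0 := by
  have hev := eventually_deformedEnergy_transf e b hΦ hS hg ht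
  have hD : |(e : Eucl d →L[ℝ] Eucl d).det| ≠ 0 := abs_ne_zero.2 (det_equiv_ne_zero e)
  rw [Filter.EventuallyEq.hasDerivWithinAt_iff (hev.filter_mono nhdsWithin_le_nhds) hev.self_of_nhds]
  constructor
  · intro h
    have := h.const_mul |(e : Eucl d →L[ℝ] Eucl d).det|⁻¹
    simpa only [inv_mul_cancel_left₀ hD] using this
  · exact fun h => h.const_mul _

end Deformation

/-! ### Weighted mean curvature -/

section WMC

variable {d : ℕ} (e : Eucl d ≃L[ℝ] Eucl d) (b : Eucl d)

theorem IsAsymNorm.differentiableAt_smul {Φ : Eucl d → ℝ} (hΦ : IsAsymNorm Φ) {n : Eucl d} {l : ℝ}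
    (hl : 0 < l) (h : DifferentiableAt ℝ Φ n) : DifferentiableAt ℝ Φ (l • n) := by
  have h1 : Φ = fun y => l * Φ (l⁻¹ • y) := by
    funext y
    rw [← hΦ.pos_homog l _ hl.le, smul_inv_smul₀ hl.ne']
  rw [h1]
  refine DifferentiableAt.const_mul ?_ l
  refine DifferentiableAt.comp (f := fun y : Eucl d => l⁻¹ • y) (l • n) ?_ (by fun_prop)
  rwa [inv_smul_smul₀ hl.ne']

theorem differentiableAt_transf_conormal {Φ : Eucl d → ℝ} (hΦ : IsAsymNorm Φ) {n : Eucl d}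
    (h : DifferentiableAt ℝ Φ n) :
    DifferentiableAt ℝ (transf (e : Eucl d →L[ℝ] Eucl d) Φ)
      (conormal (e : Eucl d →L[ℝ] Eucl d) n) := by
  refine DifferentiableAt.comp (f := ContinuousLinearMap.adjoint (e : Eucl d →L[ℝ] Eucl d)) _ ?_
    (ContinuousLinearMap.differentiableAt _)
  rw [adjoint_conormal]
  rcases eq_or_ne n 0 with rfl | hn
  · simpa using h
  · exact hΦ.differentiableAt_smul (conormalScale_pos e hn) h

theorem conormal_symm_conormal (n : Eucl d) :
    conormal (e.symm : Eucl d →L[ℝ] Eucl d) (conormal (e : Eucl d →L[ℝ] Eucl d) n) = n := by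
  rw [conormal_trans, ContinuousLinearEquiv.self_trans_symm, conormal_refl]

theorem differentiableAt_transf_conormal_iff {Φ : Eucl d → ℝ} (hΦ : IsAsymNorm Φ) {n : Eucl d} :
    DifferentiableAt ℝ (transf (e : Eucl d →L[ℝ] Eucl d) Φ)
      (conormal (e : Eucl d →L[ℝ] Eucl d) n) ↔ DifferentiableAt ℝ Φ n := by
  refine ⟨fun h => ?_, differentiableAt_transf_conormal e hΦ⟩
  have := differentiableAt_transf_conormal e.symm (isAsymNorm_transf e hΦ) h
  rwa [transf_symm_transf, conormal_symm_conormal] at this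

/-- Gradients of defining functions transform like conormals. -/
theorem gradient_comp_affMap_symm {u : Eucl d → ℝ} {z : Eucl d} (hu : DifferentiableAt ℝ u z) :
    gradient (u ∘ affMap (e.symm : Eucl d →L[ℝ] Eucl d) (-(e.symm b)))
      (affMap (e : Eucl d →L[ℝ] Eucl d) b z) =
      ContinuousLinearMap.adjoint (e.symm : Eucl d →L[ℝ] Eucl d) (gradient u z) := by
  refine HasGradientAt.gradient ?_
  rw [hasGradientAt_iff_hasFDerivAt]
  have h1 := hu.hasGradientAt.hasFDerivAt
  have h2 := hasFDerivAt_affMap e.symm (-(e.symm b)) (affMap (e : Eucl d →L[ℝ] Eucl d) b z)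
  rw [← affMap_symm_affMap e b z] at h1
  have h3 := h1.comp _ h2
  rw [affMap_symm_affMap] at h3
  have h4 : InnerProductSpace.toDual ℝ (Eucl d)
      (ContinuousLinearMap.adjoint (e.symm : Eucl d →L[ℝ] Eucl d) (gradient u z)) =
      (InnerProductSpace.toDual ℝ (Eucl d) (gradient u z)).comp
        (e.symm : Eucl d →L[ℝ] Eucl d) := by
    ext1 v
    exact ContinuousLinearMap.adjoint_inner_left (e.symm : Eucl d →L[ℝ] Eucl d) v (gradient u z)
  rw [h4]
  exact h3

theorem isRegularIn_map_affMap {S : OrientedSet d} {U : Set (Eucl d)} (hU : IsOpen U)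
    (h : IsRegularIn S U) :
    IsRegularIn (S.map (affMap (e : Eucl d →L[ℝ] Eucl d) b))
      (affMap (e : Eucl d →L[ℝ] Eucl d) b '' U) := by
  obtain ⟨u, hu, hSU, hn⟩ := h
  have hA := isBilipDiffeo_affMap e b
  refine ⟨u ∘ affMap (e.symm : Eucl d →L[ℝ] Eucl d) (-(e.symm b)), ?_, ?_, ?_⟩
  · refine hu.comp ((e.symm : Eucl d →L[ℝ] Eucl d).contDiff.add contDiff_const).contDiffOn ?_
    rintro _ ⟨x, hx, rfl⟩
    rwa [affMap_symm_affMap]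
  · show affMap (e : Eucl d →L[ℝ] Eucl d) b '' S.carrier ∩ _ = _
    rw [← image_inter hA.bijective.1, hSU]
    ext y
    obtain ⟨x, rfl⟩ := hA.bijective.2 y
    rw [hA.bijective.1.mem_set_image, mem_ofPred_eq, mem_ofPred_eq, hA.bijective.1.mem_set_image,
      Function.comp_apply, affMap_symm_affMap]
  · rintro _ ⟨⟨z, hz, rfl⟩, hzU⟩
    rw [hA.bijective.1.mem_set_image] at hzU
    have hd : DifferentiableAt ℝ u z :=
      (hu.contDiffAt (hU.mem_nhds hzU)).differentiableAt two_ne_zero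
    obtain ⟨h0, h1⟩ := hn z ⟨hz, hzU⟩
    rw [gradient_comp_affMap_symm e b hd, normal_map_affMap, h1]
    have h2 := adjoint_symm_ne_zero e h0
    refine ⟨h2, ?_⟩
    have h0' : ‖gradient u z‖ ≠ 0 := norm_ne_zero_iff.2 h0
    have h2' := norm_ne_zero_iff.2 h2
    rw [conormal_equiv, map_smul, norm_smul, norm_smul, norm_inv, norm_norm, smul_smul]
    congr 1
    field_simp

theorem HasRegularWMC.map_affMap {Φ : Eucl d → ℝ} (hΦ : IsAsymNorm Φ) {S : OrientedSet d}
    (hS : IsOrientedSurface S) {x : Eucl d} {κ : ℝ} (h : HasRegularWMC Φ S x κ) :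
    HasRegularWMC (transf (e : Eucl d →L[ℝ] Eucl d) Φ)
      (S.map (affMap (e : Eucl d →L[ℝ] Eucl d) b)) (affMap (e : Eucl d →L[ℝ] Eucl d) b x) κ := by
  obtain ⟨hx, hdiff, U, hU, hxU, hreg, k, hk, hkx, hvar⟩ := h
  have hA := isBilipDiffeo_affMap e b
  have hleft := affMap_symm_affMap e b
  set A := affMap (e : Eucl d →L[ℝ] Eucl d) b with hAdef
  refine ⟨mem_image_of_mem _ hx, ?_, A '' U, hA.toHomeomorph.isOpenMap U hU,
    mem_image_of_mem _ hxU, isRegularIn_map_affMap e b hU hreg,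
    k ∘ affMap (e.symm : Eucl d →L[ℝ] Eucl d) (-(e.symm b)), ?_, ?_, ?_⟩
  · rw [normal_map_affMap]
    exact differentiableAt_transf_conormal e hΦ hdiff
  · refine hk.comp (isBilipDiffeo_affMap e.symm _).contDiff.continuous.continuousOn ?_
    rintro _ ⟨⟨z, hz, rfl⟩, hzU⟩
    rw [hA.bijective.1.mem_set_image] at hzU
    rw [hleft]
    exact ⟨hz, hzU⟩
  · rw [Function.comp_apply, hleft, hkx]
  · intro gA hgA
    set g : Eucl d → Eucl d := fun z => e.symm (gA (A z)) with hgdef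
    have hg : ∀ z, gA (A z) = e (g z) := fun z => by rw [hgdef, e.apply_symm_apply]
    have ht := hgA.of_affMap_symm e b hg
    have h1 := (hasDerivWithinAt_deformedEnergy_transf_iff e b hΦ hS hg ht (s := univ)).2
      (hvar g ht).hasDerivWithinAt
    rw [hasDerivWithinAt_univ] at h1
    have h2 := integral_inner_map_affMap e b hS hg
      (kA := k ∘ affMap (e.symm : Eucl d →L[ℝ] Eucl d) (-(e.symm b))) (k := k)
      (fun z => by rw [Function.comp_apply, affMap_symm_affMap])
    rw [h2, ← mul_neg]
    exact h1

theorem conormalScale_mul_inner_eq_zero_iff (v n : Eucl d) :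
    conormalScale e n * ⟪v, n⟫ = 0 ↔ ⟪v, n⟫ = 0 := by
  rcases eq_or_ne n 0 with rfl | hn
  · simp
  · rw [mul_eq_zero, or_iff_right (conormalScale_pos e hn).ne']

theorem inner_affMap_sub_eq_zero_iff (S : OrientedSet d) (x z : Eucl d) :
    ⟪affMap (e : Eucl d →L[ℝ] Eucl d) b z - affMap (e : Eucl d →L[ℝ] Eucl d) b x,
      (S.map (affMap (e : Eucl d →L[ℝ] Eucl d) b)).normal
        (affMap (e : Eucl d →L[ℝ] Eucl d) b x)⟫ = 0 ↔ ⟪z - x, S.normal x⟫ = 0 := by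
  rw [affMap_equiv_sub, normal_map_affMap, inner_map_conormal, conormalScale_mul_inner_eq_zero_iff]

theorem image_flatPart_subset (S : OrientedSet d) (x : Eucl d) :
    affMap (e : Eucl d →L[ℝ] Eucl d) b '' flatPart S x ⊆
      flatPart (S.map (affMap (e : Eucl d →L[ℝ] Eucl d) b))
        (affMap (e : Eucl d →L[ℝ] Eucl d) b x) := by
  rintro _ ⟨y, ⟨hy, r, hr, hball, hnorm⟩, rfl⟩
  have hA := isBilipDiffeo_affMap e b
  set a := ‖(e.symm : Eucl d →L[ℝ] Eucl d)‖ with ha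
  have ha0 : 0 ≤ a := norm_nonneg _
  refine ⟨(inner_affMap_sub_eq_zero_iff e b S x y).2 hy, r / (a + 1), by positivity, ?_, ?_⟩
  all_goals
    have hmem : ∀ z, affMap (e : Eucl d →L[ℝ] Eucl d) b z ∈
        Metric.ball (affMap (e : Eucl d →L[ℝ] Eucl d) b y) (r / (a + 1)) →
          z ∈ Metric.ball y r := by
      intro z hz
      rw [Metric.mem_ball, dist_eq_norm, affMap_equiv_sub, lt_div_iff₀ (by positivity)] at hz
      rw [Metric.mem_ball, dist_eq_norm]
      have h1 : ‖z - y‖ ≤ a * ‖e (z - y)‖ := by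
        simpa using (e.symm : Eucl d →L[ℝ] Eucl d).le_opNorm (e (z - y))
      nlinarith [norm_nonneg (e (z - y))]
  · ext w
    obtain ⟨z, rfl⟩ := hA.bijective.2 w
    have h1 : affMap (e : Eucl d →L[ℝ] Eucl d) b z ∈
        (S.map (affMap (e : Eucl d →L[ℝ] Eucl d) b)).carrier ↔ z ∈ S.carrier :=
      hA.bijective.1.mem_set_image
    rw [mem_inter_iff, h1, mem_ofPred_eq, inner_affMap_sub_eq_zero_iff, and_comm]
    refine and_congr_right fun hz => ?_
    have h2 : z ∈ S.carrier ∩ Metric.ball y r ↔ z ∈ Metric.ball y r ∧ ⟪z - x, S.normal x⟫ = 0 := by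
      rw [hball]; rfl
    have hz' := hmem z hz
    constructor
    · exact fun h => (h2.1 ⟨h, hz'⟩).2
    · exact fun h => (h2.2 ⟨hz', h⟩).1
  · rintro _ ⟨⟨z, hz, rfl⟩, hzb⟩
    rw [normal_map_affMap, normal_map_affMap, hnorm z ⟨hz, hmem z hzb⟩]

/-- One inclusion for `A` together with the same inclusion for `A⁻¹`. -/
theorem flatPart_map_affMap (S : OrientedSet d) (x : Eucl d) :
    flatPart (S.map (affMap (e : Eucl d →L[ℝ] Eucl d) b))
        (affMap (e : Eucl d →L[ℝ] Eucl d) b x) =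
      affMap (e : Eucl d →L[ℝ] Eucl d) b '' flatPart S x := by
  refine Subset.antisymm (fun w hw => ?_) (image_flatPart_subset e b S x)
  have h1 := image_flatPart_subset e.symm (-(e.symm b))
    (S.map (affMap (e : Eucl d →L[ℝ] Eucl d) b)) (affMap (e : Eucl d →L[ℝ] Eucl d) b x)
    (mem_image_of_mem _ hw)
  rw [map_affMap_symm_map_affMap, affMap_symm_affMap] at h1
  exact ⟨_, h1, affMap_affMap_symm e b w⟩

theorem facet_map_affMap {S : OrientedSet d} {x : Eucl d} (hx : x ∈ flatPart S x) :
    facet (S.map (affMap (e : Eucl d →L[ℝ] Eucl d) b))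
        (affMap (e : Eucl d →L[ℝ] Eucl d) b x) =
      affMap (e : Eucl d →L[ℝ] Eucl d) b '' facet S x := by
  rw [facet, facet, flatPart_map_affMap]
  exact ((isBilipDiffeo_affMap e b).toHomeomorph.image_connectedComponentIn hx).symm

/-- The area of a facet scales by `|det e| / conormalScale e n`, so that normal speed times area
scales by `|det e|`. -/
theorem conormalScale_mul_measure_facet {S : OrientedSet d} {x : Eucl d}
    (hx : x ∈ flatPart S x) (hn : S.normal x ≠ 0) :
    conormalScale e (S.normal x) *
      (μHE[d - 1] (facet (S.map (affMap (e : Eucl d →L[ℝ] Eucl d) b))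
        (affMap (e : Eucl d →L[ℝ] Eucl d) b x))).toReal =
      |(e : Eucl d →L[ℝ] Eucl d).det| * (μHE[d - 1] (facet S x)).toReal := by
  rw [facet_map_affMap e b hx]
  have h1 : affMap (e : Eucl d →L[ℝ] Eucl d) b '' facet S x =
      (fun z => z + b) '' (e '' facet S x) := by
    rw [image_image]; rfl
  have hsub : facet S x ⊆ {y | ⟪y - x, S.normal x⟫ = 0} :=
    (connectedComponentIn_subset _ _).trans fun y hy => hy.1
  rw [h1, euclideanHausdorffMeasure_image_add_const,
    euclideanHausdorffMeasure_image_hyperplane e hn x hsub, ENNReal.toReal_mul,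
    ENNReal.toReal_ofReal (by positivity), conormalScale]
  have h2 := norm_ne_zero_iff.2 (adjoint_symm_ne_zero e hn)
  have h3 := norm_ne_zero_iff.2 hn
  field_simp

theorem HasFacetWMC.map_affMap {Φ : Eucl d → ℝ} (hΦ : IsAsymNorm Φ) {S : OrientedSet d}
    (hS : IsOrientedSurface S) {x : Eucl d} {κ : ℝ} (h : HasFacetWMC Φ S x κ) :
    HasFacetWMC (transf (e : Eucl d →L[ℝ] Eucl d) Φ)
      (S.map (affMap (e : Eucl d →L[ℝ] Eucl d) b)) (affMap (e : Eucl d →L[ℝ] Eucl d) b x) κ := by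
  obtain ⟨hxS, hdiff, hx, hbdd, hκ⟩ := h
  have hA := isBilipDiffeo_affMap e b
  have hxF : x ∈ facet S x := mem_connectedComponentIn hx
  -- a field of normal speed `1` on the facet exists, so the normal at `x` is not zero
  have hn : S.normal x ≠ 0 := by
    intro h0
    obtain ⟨B, hB⟩ := (hκ 1).2
    obtain ⟨g, a, hg, -⟩ := hB 1 one_pos univ isOpen_univ (subset_univ _)
    have := hg.2.2 x hxF
    rw [h0, inner_zero_right] at this
    exact zero_ne_one this
  have harea := conormalScale_mul_measure_facet e b hx hn
  have hl := conormalScale_pos e hn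
  have hD : 0 < |(e : Eucl d →L[ℝ] Eucl d).det| := abs_pos.2 (det_equiv_ne_zero e)
  have hnA := normal_map_affMap e b S x
  have hfacet := facet_map_affMap e b hx
  have hleft := affMap_symm_affMap e b
  have hdA := fun (g gA : Eucl d → Eucl d)
      (hg : ∀ z, gA (affMap (e : Eucl d →L[ℝ] Eucl d) b z) = e (g z)) (V : Set (Eucl d))
      (ht : IsTestField V g) (a : ℝ) =>
    hasDerivWithinAt_deformedEnergy_transf_iff e b hΦ hS hg ht (s := Ici 0) (a := a)
  set A := affMap (e : Eucl d →L[ℝ] Eucl d) b with hAdef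
  set l := conormalScale e (S.normal x) with hldef
  set D := |(e : Eucl d →L[ℝ] Eucl d).det| with hDdef
  set m := (μHE[d - 1] (facet S x)).toReal with hm
  set mA := (μHE[d - 1] (facet (S.map A) (A x))).toReal with hmA
  have hclos : closure (facet (S.map A) (A x)) = A '' closure (facet S x) := by
    rw [hfacet]
    exact (hA.toHomeomorph.image_closure _).symm
  refine ⟨mem_image_of_mem _ hxS, ?_, ?_, ?_, fun cA => ?_⟩
  · rw [hnA, differentiableAt_transf_conormal_iff e hΦ]
    exact hdiff
  · rw [flatPart_map_affMap]
    exact mem_image_of_mem _ hx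
  · rw [hfacet]
    obtain ⟨C, hC⟩ := hA.lipschitz
    exact hC.isBounded_image hbdd
  -- the facet moves with normal speed `c_A` after the map if it moves with speed `c_A / l` before
  have hval : ∀ δ : ℝ, -κ * (cA * mA) + δ = D * (-κ * (cA / l * m) + δ / D) := by
    intro δ
    have : cA * mA = cA / l * (D * m) := by rw [← harea]; field_simp
    rw [this]
    field_simp
  obtain ⟨hlow, hatt⟩ := hκ (cA / l)
  constructor
  · intro B ε hε
    obtain ⟨V, hV, hFV, hgV⟩ := hlow (‖(e.symm : Eucl d →L[ℝ] Eucl d)‖ * B) (ε / D) (by positivity)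
    refine ⟨A '' V, hA.toHomeomorph.isOpenMap V hV, by rw [hclos]; exact image_mono hFV, ?_⟩
    rintro gA a ⟨htA, hBA, hcA⟩ ha
    set g : Eucl d → Eucl d := fun z => e.symm (gA (A z)) with hgdef
    have hg : ∀ z, gA (A z) = e (g z) := fun z => by rw [hgdef, e.apply_symm_apply]
    have ht := htA.of_affMap_symm e b hg
    have h1 := hgV g (a / D) ⟨ht, fun y => ?_, fun y hy => ?_⟩ ?_
    · have h2 := hval (-ε)
      rw [← sub_eq_add_neg] at h2
      rw [h2]
      calc D * (-κ * (cA / l * m) + -ε / D) ≤ D * (a / D) := by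
            refine mul_le_mul_of_nonneg_left ?_ hD.le
            rw [neg_div, ← sub_eq_add_neg]
            exact h1
        _ = a := by field_simp
    · exact ((e.symm : Eucl d →L[ℝ] Eucl d).le_opNorm _).trans (by gcongr; exact hBA _)
    · have h2 := hcA (A y) (by rw [hfacet]; exact mem_image_of_mem _ hy)
      rw [hg, hnA, inner_map_conormal] at h2
      rw [eq_div_iff hl.ne', mul_comm]
      exact h2
    · rw [← hdA g gA hg _ ht, mul_div_cancel₀ _ hD.ne']
      exact ha
  · obtain ⟨B, hB⟩ := hatt
    refine ⟨‖(e : Eucl d →L[ℝ] Eucl d)‖ * B, fun ε hε VA hVA hFVA => ?_⟩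
    obtain ⟨g, a, ⟨ht, hgB, hgc⟩, ha, hle⟩ := hB (ε / D) (by positivity) (A ⁻¹' VA)
      (hVA.preimage hA.contDiff.continuous) (by
        rw [← image_subset_iff, ← hclos]; exact hFVA)
    set gA : Eucl d → Eucl d := fun y =>
      e (g (affMap (e.symm : Eucl d →L[ℝ] Eucl d) (-(e.symm b)) y)) with hgAdef
    have hg : ∀ z, gA (A z) = e (g z) := fun z => by simp only [hgAdef, hleft]
    have htA := ht.of_affMap e b hg
    rw [image_preimage_eq _ hA.bijective.2] at htA
    refine ⟨gA, D * a, ⟨htA, fun y => ?_, ?_⟩, (hdA g gA hg _ ht a).2 ha, ?_⟩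
    · exact ((e : Eucl d →L[ℝ] Eucl d).le_opNorm _).trans (by gcongr; exact hgB _)
    · rw [hfacet]
      rintro _ ⟨y, hy, rfl⟩
      rw [hg, hnA, inner_map_conormal, hgc y hy]
      exact mul_div_cancel₀ _ hl.ne'
    · rw [hval ε]
      exact mul_le_mul_of_nonneg_left hle hD.le

theorem HasWMC.map_affMap {Φ : Eucl d → ℝ} (hΦ : IsAsymNorm Φ) {S : OrientedSet d}
    (hS : IsOrientedSurface S) {x : Eucl d} {κ : ℝ} (h : HasWMC Φ S x κ) :
    HasWMC (transf (e : Eucl d →L[ℝ] Eucl d) Φ)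
      (S.map (affMap (e : Eucl d →L[ℝ] Eucl d) b)) (affMap (e : Eucl d →L[ℝ] Eucl d) b x) κ :=
  h.imp (fun h => h.map_affMap e b hΦ hS) fun h => h.map_affMap e b hΦ hS

theorem hasWMC_map_affMap_iff {Φ : Eucl d → ℝ} (hΦ : IsAsymNorm Φ) {S : OrientedSet d}
    (hS : IsOrientedSurface S) (x : Eucl d) (κ : ℝ) :
    HasWMC Φ S x κ ↔ HasWMC (transf (e : Eucl d →L[ℝ] Eucl d) Φ)
      (S.map (affMap (e : Eucl d →L[ℝ] Eucl d) b)) (affMap (e : Eucl d →L[ℝ] Eucl d) b x) κ := by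
  refine ⟨fun h => h.map_affMap e b hΦ hS, fun h => ?_⟩
  have := h.map_affMap e.symm (-(e.symm b)) (isAsymNorm_transf e hΦ)
    ((isBilipDiffeo_affMap e b).isOrientedSurface_map hS)
  rwa [transf_symm_transf, map_affMap_symm_map_affMap, affMap_symm_affMap] at this

end WMC

/-! ### Motion by weighted mean curvature -/

section Motion

variable {d : ℕ} (e : Eucl d ≃L[ℝ] Eucl d) (b : Eucl d) {C : ℝ → OrientedSet d} {T t : ℝ}

theorem mem_carrier_map_affMap {S : OrientedSet d} {x : Eucl d} :
    affMap (e : Eucl d →L[ℝ] Eucl d) b x ∈ (S.map (affMap (e : Eucl d →L[ℝ] Eucl d) b)).carrier ↔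
      x ∈ S.carrier :=
  (isBilipDiffeo_affMap e b).bijective.1.mem_set_image

theorem IsPathOn.map_affMap {x : Eucl d} {γ : ℝ → Eucl d} (h : IsPathOn C T t x γ) :
    IsPathOn (fun s => (C s).map (affMap (e : Eucl d →L[ℝ] Eucl d) b)) T t
      (affMap (e : Eucl d →L[ℝ] Eucl d) b x) (affMap (e : Eucl d →L[ℝ] Eucl d) b ∘ γ) :=
  ⟨congrArg _ h.1, h.2.mono fun _ hs => mem_image_of_mem _ hs⟩

theorem HasDerivWithinAt.affMap_comp {γ : ℝ → Eucl d} {w : Eucl d} {s : Set ℝ}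
    (h : HasDerivWithinAt γ w s t) :
    HasDerivWithinAt (affMap (e : Eucl d →L[ℝ] Eucl d) b ∘ γ) (e w) s t :=
  (hasFDerivAt_affMap e b (γ t)).comp_hasDerivWithinAt t h

/-- Paths on the family and on its image correspond, and their normal components differ by the scale
of the conormal. -/
theorem HasNormalVelocity.map_affMap {x : Eucl d} {v : ℝ} (h : HasNormalVelocity C T t x v) :
    HasNormalVelocity (fun s => (C s).map (affMap (e : Eucl d →L[ℝ] Eucl d) b)) T t
      (affMap (e : Eucl d →L[ℝ] Eucl d) b x) (conormalScale e ((C t).normal x) * v) := by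
  obtain ⟨⟨γ, w, hγ, hw⟩, hall⟩ := h
  refine ⟨⟨_, e w, hγ.map_affMap e b, hw.affMap_comp e b⟩, fun γA wA hγA hwA => ?_⟩
  have h1 := hγA.map_affMap e.symm (-(e.symm b))
  simp only [map_affMap_symm_map_affMap, affMap_symm_affMap] at h1
  have h2 := hall _ _ h1 (hwA.affMap_comp e.symm (-(e.symm b)))
  rw [normal_map_affMap, ← h2, ← inner_map_conormal, e.apply_symm_apply]

theorem IsMotion.map_affMap {Φ M : Eucl d → ℝ} (hΦ : IsAsymNorm Φ) (hM : IsAsymNorm M)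
    {Sing : ℝ → Set (Eucl d)} (h : IsMotion Φ M T C Sing) :
    IsMotion (transf (e : Eucl d →L[ℝ] Eucl d) Φ) (transf (e : Eucl d →L[ℝ] Eucl d) M) T
      (fun t => (C t).map (affMap (e : Eucl d →L[ℝ] Eucl d) b))
      (fun t => affMap (e : Eucl d →L[ℝ] Eucl d) b '' Sing t) := by
  have hA := isBilipDiffeo_affMap e b
  have hsymm : Continuous (affMap (e.symm : Eucl d →L[ℝ] Eucl d) (-(e.symm b))) :=
    (isBilipDiffeo_affMap e.symm (-(e.symm b))).contDiff.continuous
  refine ⟨fun t ht => hA.isOrientedSurface_map (h.surface t ht), ?_, ?_, ?_, ?_, ?_⟩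
  · filter_upwards [h.sing_null] with t ht
    have h1 := hA.measure_image_eq_zero ht
    rwa [image_inter hA.bijective.1] at h1
  · intro t ht y hy
    obtain ⟨x, rfl⟩ := hA.bijective.2 y
    have hx : x ∉ closure (C t).carrier := fun hx =>
      hy (image_closure_subset_closure_image hA.contDiff.continuous (mem_image_of_mem _ hx))
    have h1 : Tendsto (affMap (e.symm : Eucl d →L[ℝ] Eucl d) (-(e.symm b)))
        (𝓝 (affMap (e : Eucl d →L[ℝ] Eucl d) b x)) (𝓝 x) := by
      simpa only [affMap_symm_affMap] using
        hsymm.tendsto (affMap (e : Eucl d →L[ℝ] Eucl d) b x)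
    filter_upwards [(tendsto_id.prodMap h1).eventually (h.upper t ht x hx)] with p hp
    rwa [← affMap_affMap_symm e b p.2, mem_carrier_map_affMap]
  · intro t ht
    have h1 := (hA.quasiMeasurePreserving_invFun (d - 1) (C t).carrier).ae (h.lower t ht)
    filter_upwards [h1] with y hy N hN
    obtain ⟨x, rfl⟩ := hA.bijective.2 y
    rw [hA.invFun_apply] at hy
    filter_upwards [hy _ (hA.contDiff.continuous.continuousAt.preimage_mem_nhds hN)] with s hs
    obtain ⟨z, hz, hzN⟩ := hs
    exact ⟨_, mem_image_of_mem _ hz, hzN⟩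
  · have h1 := (continuous_conormal e).comp_continuousOn (h.normal_cont.comp
      (f := fun p : ℝ × Eucl d =>
        (p.1, affMap (e.symm : Eucl d →L[ℝ] Eucl d) (-(e.symm b)) p.2))
      (s := {p | p.1 ∈ Icc 0 T ∧
        p.2 ∈ ((C p.1).map (affMap (e : Eucl d →L[ℝ] Eucl d) b)).carrier \
          affMap (e : Eucl d →L[ℝ] Eucl d) b '' Sing p.1})
      (by fun_prop) (by
        rintro ⟨s, y⟩ ⟨hs, hy⟩
        obtain ⟨x, rfl⟩ := hA.bijective.2 y
        refine ⟨hs, ?_⟩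
        simp only [affMap_symm_affMap]
        exact ⟨(mem_carrier_map_affMap e b).1 hy.1, fun hx => hy.2 (mem_image_of_mem _ hx)⟩))
    refine h1.congr fun p _ => ?_
    obtain ⟨s, y⟩ := p
    obtain ⟨x, rfl⟩ := hA.bijective.2 y
    simp only [Function.comp_apply, affMap_symm_affMap, normal_map_affMap]
  · rintro t ht y ⟨⟨x, hx, rfl⟩, hxS⟩
    obtain ⟨κ, hκ, hv⟩ := h.velocity t ht x ⟨hx, fun hx => hxS (mem_image_of_mem _ hx)⟩
    refine ⟨κ, hκ.map_affMap e b hΦ (h.surface t ht), ?_⟩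
    have h1 := hv.map_affMap e b
    rwa [← mul_assoc, ← transf_conormal e hM, ← normal_map_affMap e b] at h1

theorem isMotion_map_affMap_iff {Φ M : Eucl d → ℝ} (hΦ : IsAsymNorm Φ) (hM : IsAsymNorm M)
    {Sing : ℝ → Set (Eucl d)} :
    IsMotion Φ M T C Sing ↔
      IsMotion (transf (e : Eucl d →L[ℝ] Eucl d) Φ) (transf (e : Eucl d →L[ℝ] Eucl d) M) T
        (fun t => (C t).map (affMap (e : Eucl d →L[ℝ] Eucl d) b))
        (fun t => affMap (e : Eucl d →L[ℝ] Eucl d) b '' Sing t) := by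
  refine ⟨fun h => h.map_affMap e b hΦ hM, fun h => ?_⟩
  have h1 := h.map_affMap e.symm (-(e.symm b)) (isAsymNorm_transf e hΦ) (isAsymNorm_transf e hM)
  simpa only [transf_symm_transf, map_affMap_symm_map_affMap, image_image, affMap_symm_affMap,
    image_id'] using h1

theorem volume_image_affMap (Ω : Set (Eucl d)) :
    volume (affMap (e : Eucl d →L[ℝ] Eucl d) b '' Ω) =
      ENNReal.ofReal |(e : Eucl d →L[ℝ] Eucl d).det| * volume Ω := by
  have h1 : affMap (e : Eucl d →L[ℝ] Eucl d) b '' Ω = (fun z => z + b) '' (e '' Ω) := by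
    rw [image_image]; rfl
  rw [h1, image_add_right, measure_preimage_add_right]
  exact Measure.addHaar_image_continuousLinearMap volume (e : Eucl d →L[ℝ] Eucl d) Ω

end Motion

theorem mainTheorem3 {d : ℕ} (hd : 2 ≤ d) (Φ M : Eucl d → ℝ) (hΦ : IsAsymNorm Φ)
    (hM : IsAsymNorm M) (L : Eucl d →L[ℝ] Eucl d) (hL : L.det ≠ 0) (b : Eucl d) :
    -- the transformed energy and mobility are again norms
    (IsAsymNorm (transf L Φ) ∧ IsAsymNorm (transf L M)) ∧
    -- the energy of the image surface
    (∀ S : OrientedSet d, IsOrientedSurface S →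
      IsOrientedSurface (S.map (affMap L b)) ∧
      energy (transf L Φ) (S.map (affMap L b)) = ENNReal.ofReal |L.det| * energy Φ S) ∧
    -- volume, and volume swept out under deformations
    (∀ Ω : Set (Eucl d), volume (affMap L b '' Ω) = ENNReal.ofReal |L.det| * volume Ω) ∧
    (∀ (S : OrientedSet d) (g gA : Eucl d → Eucl d), IsOrientedSurface S → IsTestField univ g →
      (∀ x, gA (affMap L b x) = L (g x)) →
      volumeRate (S.map (affMap L b)) gA = |L.det| * volumeRate S g) ∧
    -- weighted mean curvature
    (∀ S : OrientedSet d, IsOrientedSurface S → ∀ (x : Eucl d) (κ : ℝ),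
      HasWMC Φ S x κ ↔ HasWMC (transf L Φ) (S.map (affMap L b)) (affMap L b x) κ) ∧
    -- motion by weighted mean curvature with mobility
    (∀ (T : ℝ) (C : ℝ → OrientedSet d) (Sing : ℝ → Set (Eucl d)),
      IsMotion Φ M T C Sing ↔
        IsMotion (transf L Φ) (transf L M) T (fun t => (C t).map (affMap L b))
          (fun t => affMap L b '' Sing t)) ∧
    -- every motion for the transformed data is the image of a motion for the original data
    (∀ (T : ℝ) (CA : ℝ → OrientedSet d) (SingA : ℝ → Set (Eucl d)),
      IsMotion (transf L Φ) (transf L M) T CA SingA →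
      ∃ (C : ℝ → OrientedSet d) (Sing : ℝ → Set (Eucl d)), IsMotion Φ M T C Sing ∧
        ∀ t, SameSurface (CA t) ((C t).map (affMap L b)) ∧ SingA t = affMap L b '' Sing t) ∧
    -- so `C_A(t) = A(C(t))` in each class of motions in which the initial surface determines
    -- the motion
    (∀ (T : ℝ) (𝒦 : Set ((ℝ → OrientedSet d) × (ℝ → Set (Eucl d))))
      (C CA : ℝ → OrientedSet d) (Sing SingA : ℝ → Set (Eucl d)),
      IsMotion Φ M T C Sing → IsMotion (transf L Φ) (transf L M) T CA SingA →
      ((fun t => (C t).map (affMap L b)), (fun t => affMap L b '' Sing t)) ∈ 𝒦 →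
      (CA, SingA) ∈ 𝒦 →
      (∀ D D' : (ℝ → OrientedSet d) × (ℝ → Set (Eucl d)), D ∈ 𝒦 → D' ∈ 𝒦 →
        IsMotion (transf L Φ) (transf L M) T D.1 D.2 →
        IsMotion (transf L Φ) (transf L M) T D'.1 D'.2 →
        SameSurface (D.1 0) (D'.1 0) → ∀ t ∈ Icc 0 T, SameSurface (D.1 t) (D'.1 t)) →
      SameSurface (CA 0) ((C 0).map (affMap L b)) →
      ∀ t ∈ Icc 0 T, SameSurface (CA t) ((C t).map (affMap L b))) := by
  obtain ⟨e, rfl⟩ : ∃ e : Eucl d ≃L[ℝ] Eucl d, (e : Eucl d →L[ℝ] Eucl d) = L :=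
    ⟨L.toContinuousLinearEquivOfDetNeZero hL, L.coe_toContinuousLinearEquivOfDetNeZero hL⟩
  refine ⟨⟨isAsymNorm_transf e hΦ, isAsymNorm_transf e hM⟩, fun S hS =>
    ⟨(isBilipDiffeo_affMap e b).isOrientedSurface_map hS, energy_map_affMap e b hΦ hS⟩,
    volume_image_affMap e b, fun S g gA hS _ hg => ?_,
    fun S hS => hasWMC_map_affMap_iff e b hΦ hS,
    fun T C Sing => isMotion_map_affMap_iff e b hΦ hM,
    fun T CA SingA hCA => ?_, fun T 𝒦 C CA Sing SingA hC hCA h𝒦 h𝒦A huniq h0 => ?_⟩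
  · simpa only [volumeRate, mul_one] using
      integral_inner_map_affMap e b hS hg (k := fun _ => 1) (kA := fun _ => 1) fun _ => rfl
  · refine ⟨fun t => (CA t).map (affMap (e.symm : Eucl d →L[ℝ] Eucl d) (-(e.symm b))),
      fun t => affMap (e.symm : Eucl d →L[ℝ] Eucl d) (-(e.symm b)) '' SingA t, ?_, fun t => ?_⟩
    · have h1 := hCA.map_affMap e.symm (-(e.symm b)) (isAsymNorm_transf e hΦ)
        (isAsymNorm_transf e hM)
      rwa [transf_symm_transf, transf_symm_transf] at h1
    · rw [map_affMap_map_affMap_symm, image_image]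
      simp only [affMap_affMap_symm, image_id']
      exact ⟨⟨rfl, ae_of_all _ fun _ => rfl⟩, trivial⟩
  · exact huniq (CA, SingA) _ h𝒦A h𝒦 hCA (hC.map_affMap e b hΦ hM) h0
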